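/- Let $A$ and $B$ be rings, ${}_BM_A$ a $B$-$A$-bimodule and ${}_AN_B$ an $A$-$B$-bimodule, and let $$\Lambda=\begin{pmatrix} A & N\\ M & B\end{pmatrix},\qquad \begin{pmatrix} a & n\\ m & b\end{pmatrix}\begin{pmatrix} a' & n'\\ m' & b'\end{pmatrix} =\begin{pmatrix} aa' & an'+nb'\\ ma'+bm' & bb'\end{pmatrix},$$ be the Morita context ring with zero bimodule homomorphisms. Assume that $\Lambda$ is an Artin algebra (i.e. an algebra over a commutative artinian ring $k$ that is finitely generated as a $k$-module; then so are $A$ and $B$), that $M$ is projective as a left $B$-module, that $N$ is projective as a right $B$-module, and that $N\otimes_B M=0$. For an Artin algebra $R$ consider finitely generated right $R$-modules. A module $K$ is an $n$-th syzygy of $X$ if there is an exact sequence $0\to K\to P_{n-1}\to\cdots\to P_0\to X\to 0$ with all $P_i$ projective (for $n=0$: $K\cong X$). For nonnegative integers $m,n$, the algebra $R$ is called $(m,n)$-Igusa–Todorov if there is a module $V$ such that every $n$-th syzygy $K$ of every module admits an exact sequence $0\to V_m\to\cdots\to V_1\to V_0\to K\to 0$ in which each $V_i$ is a direct summand of a finite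 direct sum of copies of $V$. The Igusa–Todorov distance of $R$ is $$\mathrm{IT}(R)=\inf\{m\ge 0\mid R\text{ is }(m,n)\text{-Igusa–Todorov for some } n\ge 0\}.$$ Then: (1) If $A$ is $(m,r)$-Igusa–Todorov and $B$ is $(n,s)$-Igusa–Todorov, where $m,r,n,s\ge 0$, then $\Lambda$ is $(2m+n+2,\max\{r,s\})$-Igusa–Todorov. (2) $\mathrm{IT}(B)\le \mathrm{IT}(\Lambda)\le 2\,\mathrm{IT}(A)+\mathrm{IT}(B)+2.$ -/

import Mathlib

universe u v

open scoped TensorProduct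

/-! ### The noncommutative tensor product -/

/-- The tensor product `N ⊗_B M` of a right `B`-module `N` (a module over `Bᵐᵒᵖ`) and a left
`B`-module `M` over a possibly noncommutative ring `B`: the quotient of `N ⊗_ℤ M` by the
subgroup generated by the elements `(n b) ⊗ m - n ⊗ (b m)`. -/
abbrev BalancedTensor (B N M : Type u) [Ring B] [AddCommGroup N] [Module Bᵐᵒᵖ N]
    [AddCommGroup M] [Module B M] : Type u :=
  (N ⊗[ℤ] M) ⧸ Submodule.span ℤ
    {z : N ⊗[ℤ] M | ∃ (n : N) (b : B) (m : M),
      z = (MulOpposite.op b • n) ⊗ₜ[ℤ] m - n ⊗ₜ[ℤ] (b • m)}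

/-! ### The Morita context ring with zero bimodule homomorphisms -/

/-- The underlying set of the matrices `(a, n; m, b)` with `a ∈ A`, `n ∈ N`, `m ∈ M`, `b ∈ B`. -/
@[ext]
structure MoritaRing (A N M B : Type u) : Type u where
  a : A
  n : N
  m : M
  b : B

namespace MoritaRing

variable {A N M B : Type u} [Ring A] [Ring B] [AddCommGroup N] [AddCommGroup M]

instance : Zero (MoritaRing A N M B) := ⟨⟨0, 0, 0, 0⟩⟩
instance : One (MoritaRing A N M B) := ⟨⟨1, 0, 0, 1⟩⟩
instance : Add (MoritaRing A N M B) := ⟨fun x y => ⟨x.a + y.a, x.n + y.n, x.m + y.m, x.b + y.b⟩⟩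
instance : Neg (MoritaRing A N M B) := ⟨fun x => ⟨-x.a, -x.n, -x.m, -x.b⟩⟩

@[simp] theorem zero_a : (0 : MoritaRing A N M B).a = 0 := rfl
@[simp] theorem zero_n : (0 : MoritaRing A N M B).n = 0 := rfl
@[simp] theorem zero_m : (0 : MoritaRing A N M B).m = 0 := rfl
@[simp] theorem zero_b : (0 : MoritaRing A N M B).b = 0 := rfl
@[simp] theorem one_a : (1 : MoritaRing A N M B).a = 1 := rfl
@[simp] theorem one_n : (1 : MoritaRing A N M B).n = 0 := rfl
@[simp] theorem one_m : (1 : MoritaRing A N M B).m = 0 := rfl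
@[simp] theorem one_b : (1 : MoritaRing A N M B).b = 1 := rfl
@[simp] theorem add_a (x y : MoritaRing A N M B) : (x + y).a = x.a + y.a := rfl
@[simp] theorem add_n (x y : MoritaRing A N M B) : (x + y).n = x.n + y.n := rfl
@[simp] theorem add_m (x y : MoritaRing A N M B) : (x + y).m = x.m + y.m := rfl
@[simp] theorem add_b (x y : MoritaRing A N M B) : (x + y).b = x.b + y.b := rfl
@[simp] theorem neg_a (x : MoritaRing A N M B) : (-x).a = -x.a := rfl
@[simp] theorem neg_n (x : MoritaRing A N M B) : (-x).n = -x.n := rfl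
@[simp] theorem neg_m (x : MoritaRing A N M B) : (-x).m = -x.m := rfl
@[simp] theorem neg_b (x : MoritaRing A N M B) : (-x).b = -x.b := rfl

variable [Module A N] [Module Bᵐᵒᵖ N] [Module B M] [Module Aᵐᵒᵖ M]

/-- `(a, n; m, b) (a', n'; m', b') = (a a', a n' + n b'; m a' + b m', b b')`. -/
instance : Mul (MoritaRing A N M B) :=
  ⟨fun x y => ⟨x.a * y.a, x.a • y.n + MulOpposite.op y.b • x.n,
    MulOpposite.op y.a • x.m + x.b • y.m, x.b * y.b⟩⟩

@[simp] theorem mul_a (x y : MoritaRing A N M B) : (x * y).a = x.a * y.a := rfl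
@[simp] theorem mul_n (x y : MoritaRing A N M B) :
    (x * y).n = x.a • y.n + MulOpposite.op y.b • x.n := rfl
@[simp] theorem mul_m (x y : MoritaRing A N M B) :
    (x * y).m = MulOpposite.op y.a • x.m + x.b • y.m := rfl
@[simp] theorem mul_b (x y : MoritaRing A N M B) : (x * y).b = x.b * y.b := rfl

instance [SMulCommClass A Bᵐᵒᵖ N] [SMulCommClass B Aᵐᵒᵖ M] : Ring (MoritaRing A N M B) where
  add_assoc x y z := by ext <;> simp [add_assoc]
  zero_add x := by ext <;> simp
  add_zero x := by ext <;> simp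
  add_comm x y := by ext <;> simp [add_comm]
  neg_add_cancel x := by ext <;> simp
  nsmul := nsmulRec
  zsmul := zsmulRec
  zero_mul x := by ext <;> simp
  mul_zero x := by ext <;> simp
  one_mul x := by ext <;> simp
  mul_one x := by ext <;> simp
  left_distrib x y z := by
    ext <;> simp [mul_add, add_smul] <;> abel
  right_distrib x y z := by
    ext <;> simp [add_mul, add_smul] <;> abel
  mul_assoc x y z := by
    ext
    · simp [mul_assoc]
    · simp [mul_smul, smul_comm, add_assoc]
    · simp [mul_smul, smul_comm, add_assoc]
    · simp [mul_assoc]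

end MoritaRing

/-! ### Syzygies and Igusa-Todorov algebras -/

section Modules

variable (S : Type u) [Ring S]

/-- There is an exact sequence `0 → K → C_n → ⋯ → C_2 → C_1 → X → 0` of `S`-modules all of whose
`n` middle terms `C_1, …, C_n` satisfy `𝒞`. Here `C 0` stands for `X` and `C (n + 1)` for `K`;
for `n = 0` the sequence is `0 → K → X → 0`, that is, an isomorphism. -/
def HasExactSequence (𝒞 : ModuleCat.{u} S → Prop) (n : ℕ) (K X : ModuleCat.{u} S) : Prop :=
  ∃ (C : ℕ → ModuleCat.{u} S) (d : ∀ i, C (i + 1) →ₗ[S] C i),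
    Nonempty (C 0 ≃ₗ[S] X) ∧ Nonempty (C (n + 1) ≃ₗ[S] K) ∧
    (∀ i < n, 𝒞 (C (i + 1))) ∧
    Function.Surjective (d 0) ∧
    (∀ i < n, Function.Exact (d (i + 1)) (d i)) ∧
    Function.Injective (d n)

/-- `P` is a projective object of the category of finitely generated `S`-modules. -/
def IsFGProjective (P : ModuleCat.{u} S) : Prop :=
  Module.Finite S P ∧ Module.Projective S P

/-- `K` is an `n`-th syzygy of `X`: there is an exact sequence
`0 → K → P_{n-1} → ⋯ → P_0 → X → 0` with finitely generated projective `P_i`. -/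
def IsSyzygy (n : ℕ) (K X : ModuleCat.{u} S) : Prop :=
  HasExactSequence S (IsFGProjective S) n K X

/-- `W ∈ add V`: `W` is a direct summand of a finite direct sum of copies of `V`. -/
def IsInAdd (V W : ModuleCat.{u} S) : Prop :=
  ∃ (k : ℕ) (i : W →ₗ[S] (Fin k → V)) (p : (Fin k → V) →ₗ[S] W), p ∘ₗ i = LinearMap.id

/-- The category of finitely generated left `S`-modules is `(m, n)`-Igusa-Todorov: there is a
finitely generated `V` such that every `n`-th syzygy `K` of a finitely generated module has an
exact sequence `0 → V_m → ⋯ → V_1 → V_0 → K → 0` with all `V_i` in `add V`. -/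
def IsIgusaTodorovMod (m n : ℕ) : Prop :=
  ∃ V : ModuleCat.{u} S, Module.Finite S V ∧
    ∀ X K : ModuleCat.{u} S, Module.Finite S X → Module.Finite S K → IsSyzygy S n K X →
      HasExactSequence S (IsInAdd S V) (m + 1) (ModuleCat.of S PUnit.{u + 1}) K

end Modules

/-- The ring `R` is an `(m, n)`-Igusa-Todorov algebra, in terms of finitely generated right
`R`-modules (modules over `Rᵐᵒᵖ`). -/
def IsIgusaTodorov (R : Type u) [Ring R] (m n : ℕ) : Prop :=
  IsIgusaTodorovMod Rᵐᵒᵖ m n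

/-- The Igusa-Todorov distance
`IT(R) = inf {m | R is an (m, n)-Igusa-Todorov algebra for some n}`, with `inf ∅ = ∞`. -/
noncomputable def ITDistance (R : Type u) [Ring R] : ℕ∞ :=
  sInf {d : ℕ∞ | ∃ m n : ℕ, d = m ∧ IsIgusaTodorov R m n}

/-! Let `e₂` be the idempotent of `Λ` with single entry `1 ∈ B`. For a right `Λ`-module `Z`,
multiplication `Z e₂ ⊗_B e₂Λ → Z` (`counit`) has as cokernel the `A`-module `Z / Z e₂Λ` (`Coker`).
Since `e₂Λ = M ⊕ B` is left `B`-projective, `Z ↦ Z e₂ ⊗_B e₂Λ` is exact. For `Z = Λ` its value is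
`(N ⊗_B M) ⊕ N ⊕ M ⊕ B`, so `N ⊗_B M = 0` makes the counit injective on `Λ`, hence on projectives
and on their submodules. Every syzygy over `Λ` is therefore an extension of an inflated `A`-module
by a module induced from `B`.

Let `K` be a `max r s`-th syzygy and `L` a first syzygy of `K`. The functor `Z ↦ Z e₂` is exact and
preserves projectives, because `Λe₂ = N ⊕ B` is right `B`-projective. The functor `Z ↦ Z / Z e₂Λ`
preserves projectives and is exact once the right-hand term has injective counit (`Coker.map_SES`),
that is, from the first syzygy on. This costs one step on the `A` side, which is why `L` replaces
`K`. Thus `L e₂` and `L / L e₂Λ` are syzygies of sufficient order over `B` and `A`, with resolutions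
of `n + 1` and `m + 1` terms. `AddResolution.exists_extension` combines them into `2m + n + 2` terms
for `L`, and a projective mapping onto `K` supplies the last of the `2m + n + 3` terms required.

For the lower bound, induction `- ⊗_B e₂Λ` carries syzygies over `B` to syzygies over `Λ`, the exact
functor `Z ↦ Z e₂` carries resolutions back, and the composite is the identity
(`Induced.exists_corner_equiv`). -/

/-! ### Short exact sequences and chains of them -/

section ShortExact

variable (S : Type u) [Ring S]

/-- There is a short exact sequence `0 → X → Y → Z → 0` of `S`-modules. -/
def SES (X Y Z : Type u) [AddCommGroup X] [Module S X] [AddCommGroup Y] [Module S Y]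
    [AddCommGroup Z] [Module S Z] : Prop :=
  ∃ (i : X →ₗ[S] Y) (p : Y →ₗ[S] Z),
    Function.Injective i ∧ Function.Exact i p ∧ Function.Surjective p

variable {S}
variable {X Y Z K P W D E Q : Type u} [AddCommGroup X] [Module S X] [AddCommGroup Y] [Module S Y]
  [AddCommGroup Z] [Module S Z] [AddCommGroup K] [Module S K] [AddCommGroup P] [Module S P]
  [AddCommGroup W] [Module S W] [AddCommGroup D] [Module S D] [AddCommGroup E] [Module S E]
  [AddCommGroup Q] [Module S Q]

namespace SES

theorem of_surjective (p : Y →ₗ[S] Z) (hp : Function.Surjective p) :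
    SES S (LinearMap.ker p) Y Z :=
  ⟨(LinearMap.ker p).subtype, p, Subtype.val_injective, p.exact_subtype_ker_map, hp⟩

theorem congr_left (h : SES S X Y Z) (e : K ≃ₗ[S] X) : SES S K Y Z := by
  obtain ⟨i, p, hi, hip, hp⟩ := h
  refine ⟨i ∘ₗ e.toLinearMap, p, hi.comp e.injective, fun y => ?_, hp⟩
  rw [hip y]
  constructor
  · rintro ⟨x, rfl⟩; exact ⟨e.symm x, by simp⟩
  · rintro ⟨x, rfl⟩; exact ⟨e x, rfl⟩

theorem congr_right (h : SES S X Y Z) (e : Z ≃ₗ[S] K) : SES S X Y K := by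
  obtain ⟨i, p, hi, hip, hp⟩ := h
  refine ⟨i, e.toLinearMap ∘ₗ p, hi, fun y => ?_, e.surjective.comp hp⟩
  rw [← hip y]; simp

theorem of_subsingleton_right [Subsingleton Z] (e : X ≃ₗ[S] Y) : SES S X Y Z :=
  ⟨e.toLinearMap, 0, e.injective,
    fun y => ⟨fun _ => ⟨e.symm y, by simp⟩, fun _ => Subsingleton.elim _ _⟩,
    fun z => ⟨0, Subsingleton.elim _ _⟩⟩

theorem of_subsingleton_left [Subsingleton X] (e : Y ≃ₗ[S] Z) : SES S X Y Z :=
  ⟨0, e.toLinearMap, fun _ _ _ => Subsingleton.elim _ _,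
    fun y => ⟨fun h => ⟨0, (e.map_eq_zero_iff.1 h).symm⟩, by rintro ⟨x, rfl⟩; simp⟩, e.surjective⟩

theorem exists_equiv_right [Subsingleton X] (h : SES S X Y Z) : Nonempty (Y ≃ₗ[S] Z) := by
  obtain ⟨i, p, hi, hip, hp⟩ := h
  refine ⟨LinearEquiv.ofBijective p ⟨(injective_iff_map_eq_zero p).2 fun y hy => ?_, hp⟩⟩
  obtain ⟨x, rfl⟩ := (hip y).1 hy
  rw [Subsingleton.elim x 0, map_zero]

theorem finite_right (h : SES S X Y Z) [Module.Finite S Y] : Module.Finite S Z := by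
  obtain ⟨i, p, -, -, hp⟩ := h
  exact Module.Finite.of_surjective p hp

theorem finite_left [IsNoetherianRing S] (h : SES S X Y Z) [Module.Finite S Y] :
    Module.Finite S X := by
  obtain ⟨i, p, hi, -, -⟩ := h
  exact Module.Finite.of_injective i hi

theorem finite_middle (h : SES S X Y Z) [Module.Finite S X] [Module.Finite S Z] :
    Module.Finite S Y := by
  obtain ⟨i, p, hi, hip, hp⟩ := h
  have h1 : Module.Finite S (LinearMap.ker p) := by
    rw [LinearMap.exact_iff.1 hip]; infer_instance
  have h2 : Module.Finite S (Y ⧸ LinearMap.ker p) :=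
    Module.Finite.equiv (p.quotKerEquivOfSurjective hp).symm
  exact Module.Finite.of_submodule_quotient (LinearMap.ker p)

/-- `0 → K → X ⊕ P → Y → 0` for an extension `Y` of `Z` by `X` and a projective presentation
`0 → K → P → Z → 0`. -/
theorem rotate [Module.Projective S P] (h : SES S X Y Z) (h' : SES S K P Z) :
    SES S K (X × P) Y := by
  obtain ⟨i, p, hi, hip, hp⟩ := h
  obtain ⟨j, q, hj, hjq, hq⟩ := h'
  obtain ⟨l, hl⟩ := Module.projective_lifting_property p q hp
  have hl' : ∀ x, p (l x) = q x := fun x => LinearMap.congr_fun hl x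
  have hpi : ∀ x, p (i x) = 0 := fun x => (hip _).2 ⟨x, rfl⟩
  have hker : ∀ k, ∃ x, i x = l (j k) := fun k =>
    (hip _).1 (by rw [hl']; exact (hjq _).2 ⟨k, rfl⟩)
  let pr : (X × P) →ₗ[S] Y := i.coprod l
  have hpr : Function.Surjective pr := by
    intro y
    obtain ⟨c, hc⟩ := hq (p y)
    obtain ⟨x, hx⟩ := (hip (y - l c)).1 (by rw [map_sub, hl', hc, sub_self])
    exact ⟨(x, c), by simp [pr, hx]⟩
  have hmem : ∀ z, z ∈ LinearMap.ker pr → q z.2 = 0 := by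
    rintro ⟨x, c⟩ hz
    have h0 : i x + l c = 0 := by simpa [pr] using hz
    have := congrArg p h0
    simpa [hpi, hl'] using this
  -- If `i x + l c = 0`, then `q c = 0`, and `x` is determined by `c` since `i` is injective. So the
  -- second coordinate identifies the kernel of `pr` with that of `q`.
  let f : LinearMap.ker pr →ₗ[S] LinearMap.ker q :=
    ((LinearMap.snd S X P).comp (LinearMap.ker pr).subtype).codRestrict _
      fun z => hmem z.1 z.2
  have hf : Function.Bijective f := by
    constructor
    · refine (injective_iff_map_eq_zero f).2 ?_
      rintro ⟨⟨x, c⟩, hz⟩ h0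
      have hc : c = 0 := congrArg Subtype.val h0
      subst hc
      have h0 : i x = 0 := by simpa [pr] using hz
      have hx : x = 0 := hi (by rw [h0, map_zero])
      subst hx; rfl
    · rintro ⟨c, hc⟩
      obtain ⟨k, rfl⟩ := (hjq _).1 hc
      obtain ⟨x, hx⟩ := hker k
      exact ⟨⟨(-x, j k), by simp [pr, hx]⟩, rfl⟩
  have e : K ≃ₗ[S] LinearMap.ker q :=
    (LinearEquiv.ofInjective j hj).trans (LinearEquiv.ofEq _ _ (LinearMap.exact_iff.1 hjq).symm)
  exact (of_surjective pr hpr).congr_left (e.trans (LinearEquiv.ofBijective f hf).symm)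

/-- The kernel of a composite of two epimorphisms. -/
theorem comp (h : SES S X D E) (h' : SES S K E Y) :
    ∃ T : ModuleCat.{u} S, SES S T D Y ∧ SES S X T K := by
  obtain ⟨i, p, hi, hip, hp⟩ := h
  obtain ⟨j, q, hj, hjq, hq⟩ := h'
  have hpi : ∀ x, p (i x) = 0 := fun x => (hip _).2 ⟨x, rfl⟩
  let T := LinearMap.ker (q ∘ₗ p)
  let i' : X →ₗ[S] T := i.codRestrict _ fun x => by
    change q (p (i x)) = 0
    rw [hpi, map_zero]
  let p' : T →ₗ[S] LinearMap.ker q := (p ∘ₗ T.subtype).codRestrict _ fun z => z.2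
  have e : K ≃ₗ[S] LinearMap.ker q :=
    (LinearEquiv.ofInjective j hj).trans (LinearEquiv.ofEq _ _ (LinearMap.exact_iff.1 hjq).symm)
  have hT : SES S X T (LinearMap.ker q) := by
    refine ⟨i', p', fun x y hxy => hi (congrArg Subtype.val hxy), fun z => ?_, ?_⟩
    · constructor
      · intro hz
        obtain ⟨x, hx⟩ := (hip z.1).1 (congrArg Subtype.val hz)
        exact ⟨x, Subtype.ext hx⟩
      · rintro ⟨x, rfl⟩
        exact Subtype.ext (hpi x)
    · rintro ⟨y, hy⟩
      obtain ⟨d, rfl⟩ := hp y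
      exact ⟨⟨d, hy⟩, rfl⟩
  exact ⟨ModuleCat.of S T, of_surjective _ (hq.comp hp), hT.congr_right e.symm⟩

/-- The pullback of an extension. -/
theorem pullback (h : SES S X Y Z) (h' : SES S K W Z) :
    ∃ T : ModuleCat.{u} S, SES S X T W ∧ SES S K T Y := by
  obtain ⟨i, p, hi, hip, hp⟩ := h
  obtain ⟨j, q, hj, hjq, hq⟩ := h'
  have hpi : ∀ x, p (i x) = 0 := fun x => (hip _).2 ⟨x, rfl⟩
  have hqj : ∀ x, q (j x) = 0 := fun x => (hjq _).2 ⟨x, rfl⟩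
  let T := LinearMap.ker ((p ∘ₗ LinearMap.fst S Y W) - (q ∘ₗ LinearMap.snd S Y W))
  have hT : ∀ y w, (y, w) ∈ T ↔ p y = q w := fun y w => by simp [T, sub_eq_zero]
  let iX : X →ₗ[S] T := ((LinearMap.inl S Y W) ∘ₗ i).codRestrict _ fun x => by simp [T, hpi]
  let iK : K →ₗ[S] T := ((LinearMap.inr S Y W) ∘ₗ j).codRestrict _ fun x => by simp [T, hqj]
  refine ⟨ModuleCat.of S T, ⟨iX, (LinearMap.snd S Y W) ∘ₗ T.subtype, ?_, ?_, ?_⟩,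
    ⟨iK, (LinearMap.fst S Y W) ∘ₗ T.subtype, ?_, ?_, ?_⟩⟩
  · exact fun x y hxy => hi (congrArg (fun t : T => t.1.1) hxy)
  · rintro ⟨⟨y, w⟩, hz⟩
    constructor
    · intro h0
      have h0 : w = 0 := h0
      subst h0
      obtain ⟨x, rfl⟩ := (hip y).1 (by rw [(hT _ _).1 hz, map_zero])
      exact ⟨x, rfl⟩
    · rintro ⟨x, hx⟩
      exact (congrArg (fun t : T => t.1.2) hx).symm
  · intro w
    obtain ⟨y, hy⟩ := hp (q w)
    exact ⟨⟨(y, w), (hT _ _).2 hy⟩, rfl⟩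
  · exact fun x y hxy => hj (congrArg (fun t : T => t.1.2) hxy)
  · rintro ⟨⟨y, w⟩, hz⟩
    constructor
    · intro h0
      have h0 : y = 0 := h0
      subst h0
      obtain ⟨x, rfl⟩ := (hjq w).1 (by rw [← (hT _ _).1 hz, map_zero])
      exact ⟨x, rfl⟩
    · rintro ⟨x, hx⟩
      exact (congrArg (fun t : T => t.1.1) hx).symm
  · intro y
    obtain ⟨w, hw⟩ := hq (p y)
    exact ⟨⟨(y, w), (hT _ _).2 hw.symm⟩, rfl⟩

theorem prod_left (h : SES S X Y Z) : SES S (X × P) (Y × P) Z := by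
  obtain ⟨i, p, hi, hip, hp⟩ := h
  refine ⟨i.prodMap LinearMap.id, p ∘ₗ LinearMap.fst S Y P, ?_, ?_, ?_⟩
  · rintro ⟨x, c⟩ ⟨x', c'⟩ hx
    simp only [LinearMap.prodMap_apply, LinearMap.id_apply, Prod.mk.injEq] at hx
    exact Prod.ext (hi hx.1) hx.2
  · rintro ⟨y, c⟩
    constructor
    · intro h0
      obtain ⟨x, rfl⟩ := (hip y).1 h0
      exact ⟨(x, c), rfl⟩
    · rintro ⟨⟨x, c'⟩, hx⟩
      have h1 : i x = y := congrArg Prod.fst hx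
      exact (hip y).2 ⟨x, h1⟩
  · intro z
    obtain ⟨y, rfl⟩ := hp z
    exact ⟨(y, 0), rfl⟩

theorem prod_right (h : SES S X Y Z) : SES S X (Y × P) (Z × P) := by
  obtain ⟨i, p, hi, hip, hp⟩ := h
  refine ⟨LinearMap.inl S Y P ∘ₗ i, p.prodMap LinearMap.id,
    fun x y hxy => hi (congrArg Prod.fst hxy), ?_, ?_⟩
  · rintro ⟨y, c⟩
    constructor
    · intro h0
      have hc : c = 0 := congrArg Prod.snd h0
      subst hc
      obtain ⟨x, rfl⟩ := (hip y).1 (congrArg Prod.fst h0)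
      exact ⟨x, rfl⟩
    · rintro ⟨x, hx⟩
      have h1 : i x = y := congrArg Prod.fst hx
      have h2 : 0 = c := congrArg Prod.snd hx
      exact Prod.ext ((hip y).2 ⟨x, h1⟩) h2.symm
  · rintro ⟨z, c⟩
    obtain ⟨y, rfl⟩ := hp z
    exact ⟨(y, c), rfl⟩

theorem exists_cover (X : Type u) [AddCommGroup X] [Module S X] [Module.Finite S X] :
    ∃ K P : ModuleCat.{u} S, IsFGProjective S P ∧ SES S K P X := by
  obtain ⟨n, f, hf⟩ := Module.Finite.exists_fin' S X
  exact ⟨ModuleCat.of S (LinearMap.ker f), ModuleCat.of S (Fin n → S),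
    ⟨inferInstanceAs (Module.Finite S (Fin n → S)),
      inferInstanceAs (Module.Projective S (Fin n → S))⟩, of_surjective f hf⟩

end SES

/-- There is an exact sequence `0 → K → C_n → ⋯ → C_1 → X → 0` with all `C_i` in `𝒞`, as a
composite of short exact sequences. -/
def Chain (𝒞 : ModuleCat.{u} S → Prop) : ℕ → ModuleCat.{u} S → ModuleCat.{u} S → Prop
  | 0, K, X => Nonempty (K ≃ₗ[S] X)
  | n + 1, K, X => ∃ C Y : ModuleCat.{u} S, 𝒞 C ∧ SES S Y C X ∧ Chain 𝒞 n K Y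

/-- With its converse `HasExactSequence.chain`, this replaces long exact sequences by iterated short
ones, on which inductions and functors act one step at a time. -/
theorem HasExactSequence.of_chain {𝒞 : ModuleCat.{u} S → Prop} {n : ℕ} {K X : ModuleCat.{u} S}
    (h : Chain 𝒞 n K X) : HasExactSequence S 𝒞 n K X := by
  induction n generalizing X with
  | zero =>
    obtain ⟨e⟩ := h
    exact ⟨fun _ => X, fun _ => LinearMap.id, ⟨LinearEquiv.refl S X⟩, ⟨e.symm⟩,
      fun i hi => absurd hi (Nat.not_lt_zero i), Function.surjective_id,
      fun i hi => absurd hi (Nat.not_lt_zero i), Function.injective_id⟩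
  | succ n ih =>
    obtain ⟨C, Y, hC, ⟨i, p, hi, hip, hp⟩, h⟩ := h
    obtain ⟨D, d, ⟨e0⟩, ⟨e1⟩, hD, hs, hex, hinj⟩ := ih h
    -- `D 0` is only a copy of the kernel `Y`, so it is dropped; the splice is the composite `D 1 →
    -- D 0 ≃ Y → C`.
    let D' : ℕ → ModuleCat.{u} S := fun
      | 0 => X
      | 1 => C
      | j + 2 => D (j + 1)
    let d' : ∀ j, D' (j + 1) →ₗ[S] D' j := fun
      | 0 => p
      | 1 => i ∘ₗ e0.toLinearMap ∘ₗ d 0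
      | j + 2 => d (j + 1)
    have hie : Function.Injective (i ∘ₗ e0.toLinearMap) := hi.comp e0.injective
    refine ⟨D', d', ⟨LinearEquiv.refl S X⟩, ⟨e1⟩, ?_, hp, ?_, ?_⟩
    · rintro (_ | j) hj
      · exact hC
      · exact hD j (by omega)
    · rintro (_ | _ | j) hj y
      · refine (hip y).trans ⟨?_, ?_⟩
        · rintro ⟨z, rfl⟩
          obtain ⟨c, hc⟩ := hs (e0.symm z)
          exact ⟨c, by change i (e0 (d 0 c)) = i z; rw [hc, e0.apply_symm_apply]⟩
        · rintro ⟨c, rfl⟩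
          exact ⟨e0 (d 0 c), rfl⟩
      · refine Iff.trans ?_ (hex 0 (by omega) y)
        exact ⟨fun h0 => hie (h0.trans (map_zero _).symm), fun h0 => by
          change i (e0 (d 0 y)) = 0
          rw [h0, map_zero, map_zero]⟩
      · exact hex (j + 1) (by omega) y
    -- For `n = 0` the last map is the splice itself; otherwise it is the last map of the tail.
    · cases n with
      | zero => exact hie.comp hinj
      | succ n => exact hinj

theorem HasExactSequence.chain {𝒞 : ModuleCat.{u} S → Prop} {n : ℕ} {K X : ModuleCat.{u} S}
    (h : HasExactSequence S 𝒞 n K X) : Chain 𝒞 n K X := by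
  induction n generalizing X with
  | zero =>
    obtain ⟨C, d, ⟨e0⟩, ⟨e1⟩, -, hs, -, hi⟩ := h
    exact ⟨e1.symm.trans ((LinearEquiv.ofBijective (d 0) ⟨hi, hs⟩).trans e0)⟩
  | succ n ih =>
    obtain ⟨C, d, ⟨e0⟩, ⟨e1⟩, hC, hs, hex, hi⟩ := h
    -- The tail is read as an exact sequence ending in the kernel of `d 0`.
    let C' : ℕ → ModuleCat.{u} S := fun
      | 0 => ModuleCat.of S (LinearMap.ker (d 0))
      | j + 1 => C (j + 2)
    let d' : ∀ j, C' (j + 1) →ₗ[S] C' j := fun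
      | 0 => (d 1).codRestrict (LinearMap.ker (d 0))
          fun c => (hex 0 (Nat.succ_pos n) _).2 ⟨c, rfl⟩
      | j + 1 => d (j + 2)
    refine ⟨C 1, C' 0, hC 0 (Nat.succ_pos n), (SES.of_surjective (d 0) hs).congr_right e0,
      ih ⟨C', d', ⟨LinearEquiv.refl S _⟩, ⟨e1⟩, fun j hj => hC (j + 1) (by omega), ?_, ?_, ?_⟩⟩
    · rintro ⟨c, hc⟩
      obtain ⟨b, rfl⟩ := (hex 0 (Nat.succ_pos n) c).1 hc
      exact ⟨b, rfl⟩
    · rintro (_ | j) hj y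
      · refine Iff.trans ?_ (hex 1 (by omega) y)
        exact ⟨fun h0 => congrArg Subtype.val h0, fun h0 => Subtype.ext h0⟩
      · exact hex (j + 2) (by omega) y
    · cases n with
      | zero => exact fun x y hxy => hi (congrArg Subtype.val hxy)
      | succ n => exact hi

namespace Chain

variable {𝒞 𝒟 : ModuleCat.{u} S → Prop}

theorem mono (h𝒞 : ∀ C, 𝒞 C → 𝒟 C) {n : ℕ} {K X : ModuleCat.{u} S} (h : Chain 𝒞 n K X) :
    Chain 𝒟 n K X := by
  induction n generalizing X with
  | zero => exact h
  | succ n ih =>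
    obtain ⟨C, Y, hC, hs, h⟩ := h
    exact ⟨C, Y, h𝒞 C hC, hs, ih h⟩

theorem congr_right {n : ℕ} {K X X' : ModuleCat.{u} S} (h : Chain 𝒞 n K X) (e : X ≃ₗ[S] X') :
    Chain 𝒞 n K X' := by
  cases n with
  | zero => exact h.map fun f => f.trans e
  | succ n =>
    obtain ⟨C, Y, hC, hs, h⟩ := h
    exact ⟨C, Y, hC, hs.congr_right e, h⟩

theorem congr_left {n : ℕ} {K K' X : ModuleCat.{u} S} (h : Chain 𝒞 n K X) (e : K' ≃ₗ[S] K) :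
    Chain 𝒞 n K' X := by
  induction n generalizing X with
  | zero => exact h.map fun f => e.trans f
  | succ n ih =>
    obtain ⟨C, Y, hC, hs, h⟩ := h
    exact ⟨C, Y, hC, hs, ih h⟩

theorem snoc {n : ℕ} {K C Y X : ModuleCat.{u} S} (h : Chain 𝒞 n Y X) (hC : 𝒞 C)
    (hs : SES S K C Y) : Chain 𝒞 (n + 1) K X := by
  induction n generalizing X with
  | zero =>
    obtain ⟨e⟩ := h
    exact ⟨C, K, hC, hs.congr_right e, ⟨LinearEquiv.refl S K⟩⟩
  | succ n ih =>
    obtain ⟨D, Z, hD, hs', h⟩ := h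
    exact ⟨D, Z, hD, hs', ih h⟩

theorem split {m n : ℕ} {K X : ModuleCat.{u} S} (h : Chain 𝒞 (m + n) K X) :
    ∃ Y, Chain 𝒞 m K Y ∧ Chain 𝒞 n Y X := by
  induction n generalizing X with
  | zero => exact ⟨X, h, ⟨LinearEquiv.refl S X⟩⟩
  | succ n ih =>
    obtain ⟨C, Y, hC, hs, h⟩ := h
    obtain ⟨Z, h1, h2⟩ := ih h
    exact ⟨Z, h1, C, Y, hC, hs, h2⟩

theorem finite [IsNoetherianRing S] (h𝒞 : ∀ C, 𝒞 C → Module.Finite S C) {n : ℕ}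
    {K X : ModuleCat.{u} S} (h : Chain 𝒞 n K X) (hX : Module.Finite S X) :
    Module.Finite S K := by
  induction n generalizing X with
  | zero => obtain ⟨e⟩ := h; exact Module.Finite.equiv e.symm
  | succ n ih =>
    obtain ⟨C, Y, hC, hs, h⟩ := h
    have := h𝒞 C hC
    exact ih h hs.finite_left

/-- The image of a chain under a map on objects that preserves isomorphisms and, on the class `Q`,
the short exact sequences in the chain. -/
theorem map {R : Type u} [Ring R] {ℰ : ModuleCat.{u} R → Prop}
    (T : ModuleCat.{u} S → ModuleCat.{u} R) (Q : ModuleCat.{u} S → Prop)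
    (hiso : ∀ X Y : ModuleCat.{u} S, (X ≃ₗ[S] Y) → Nonempty (T X ≃ₗ[R] T Y))
    (h𝒞 : ∀ C, 𝒞 C → ℰ (T C))
    (hs : ∀ Y C X : ModuleCat.{u} S, 𝒞 C → Q X → SES S Y C X → Q Y ∧ SES R (T Y) (T C) (T X))
    {n : ℕ} {K X : ModuleCat.{u} S} (h : Chain 𝒞 n K X) (hX : Q X) :
    Chain ℰ n (T K) (T X) := by
  induction n generalizing X with
  | zero => obtain ⟨e⟩ := h; exact hiso _ _ e
  | succ n ih =>
    obtain ⟨C, Y, hC, hs', h⟩ := h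
    obtain ⟨hY, hs''⟩ := hs Y C X hC hX hs'
    exact ⟨T C, T Y, h𝒞 C hC, hs'', ih h hY⟩

end Chain

end ShortExact

/-! ### Resolutions by direct summands of powers of a module -/

section Add

variable {S : Type u} [Ring S]

/-- The identity `∑ p_j i_j = 1` is the form of the condition that additive functors preserve and
that avoids any bookkeeping with powers of `V`. -/
theorem isInAdd_iff {V W : ModuleCat.{u} S} :
    IsInAdd S V W ↔ ∃ (k : ℕ) (i : Fin k → (W →ₗ[S] V)) (p : Fin k → (V →ₗ[S] W)),
      ∀ w, ∑ j, p j (i j w) = w := by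
  constructor
  · rintro ⟨k, i, p, h⟩
    refine ⟨k, fun j => LinearMap.proj j ∘ₗ i, fun j => p ∘ₗ LinearMap.single S (fun _ => V) j,
      fun w => ?_⟩
    calc ∑ j, p (Pi.single j (i w j)) = p (∑ j, Pi.single j (i w j)) := (map_sum p _ _).symm
      _ = p (i w) := by rw [Finset.univ_sum_single]
      _ = w := LinearMap.congr_fun h w
  · rintro ⟨k, i, p, h⟩
    refine ⟨k, LinearMap.pi i, ∑ j, p j ∘ₗ LinearMap.proj j, LinearMap.ext fun w => ?_⟩
    simpa using h w

theorem IsInAdd.of_fintype {V W : ModuleCat.{u} S} {ι : Type*} [Fintype ι] (i : ι → (W →ₗ[S] V))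
    (p : ι → (V →ₗ[S] W)) (h : ∀ w, ∑ j, p j (i j w) = w) : IsInAdd S V W := by
  refine isInAdd_iff.2 ⟨Fintype.card ι, fun j => i ((Fintype.equivFin ι).symm j),
    fun j => p ((Fintype.equivFin ι).symm j), fun w => ?_⟩
  rw [Equiv.sum_comp (Fintype.equivFin ι).symm fun j => p j (i j w)]
  exact h w

namespace IsInAdd

theorem of_retract {V W : ModuleCat.{u} S} (i : W →ₗ[S] V) (p : V →ₗ[S] W)
    (h : ∀ w, p (i w) = w) : IsInAdd S V W :=
  of_fintype (ι := Unit) (fun _ => i) (fun _ => p) (by simpa using h)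

theorem trans {U V W : ModuleCat.{u} S} (h : IsInAdd S V W) (h' : IsInAdd S U V) :
    IsInAdd S U W := by
  obtain ⟨k, i, p, h⟩ := isInAdd_iff.1 h
  obtain ⟨l, i', p', h'⟩ := isInAdd_iff.1 h'
  refine of_fintype (ι := Fin k × Fin l) (fun j => i' j.2 ∘ₗ i j.1) (fun j => p j.1 ∘ₗ p' j.2)
    fun w => ?_
  simp only [LinearMap.comp_apply, Fintype.sum_prod_type, ← map_sum, h', h]

theorem prod {V W W' : ModuleCat.{u} S} (h : IsInAdd S V W) (h' : IsInAdd S V W') :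
    IsInAdd S V (ModuleCat.of S (W × W')) := by
  obtain ⟨k, i, p, h⟩ := isInAdd_iff.1 h
  obtain ⟨l, i', p', h'⟩ := isInAdd_iff.1 h'
  refine of_fintype (ι := Fin k ⊕ Fin l)
    (Sum.elim (fun j => i j ∘ₗ LinearMap.fst S W W') (fun j => i' j ∘ₗ LinearMap.snd S W W'))
    (Sum.elim (fun j => LinearMap.inl S W W' ∘ₗ p j) (fun j => LinearMap.inr S W W' ∘ₗ p' j))
    fun w => ?_
  simp only [Fintype.sum_sum_type, Sum.elim_inl, Sum.elim_inr, LinearMap.comp_apply, ← map_sum,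
    LinearMap.fst_apply, LinearMap.snd_apply, h, h']
  simp

theorem left (V W : ModuleCat.{u} S) : IsInAdd S (ModuleCat.of S (V × W)) V :=
  of_retract (LinearMap.inl S V W) (LinearMap.fst S V W) fun _ => rfl

theorem right (V W : ModuleCat.{u} S) : IsInAdd S (ModuleCat.of S (V × W)) W :=
  of_retract (LinearMap.inr S V W) (LinearMap.snd S V W) fun _ => rfl

theorem of_equiv {V W : ModuleCat.{u} S} (e : V ≃ₗ[S] W) : IsInAdd S V W :=
  of_retract e.symm.toLinearMap e.toLinearMap fun w => e.apply_symm_apply w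

theorem of_isFGProjective {P : ModuleCat.{u} S} (h : IsFGProjective S P) :
    IsInAdd S (ModuleCat.of S S) P := by
  obtain ⟨h1, h2⟩ := h
  obtain ⟨n, f, hf⟩ := Module.Finite.exists_fin' S P
  obtain ⟨g, hg⟩ := Module.projective_lifting_property f LinearMap.id hf
  exact ⟨n, g, f, hg⟩

theorem finite {V W : ModuleCat.{u} S} (hV : Module.Finite S V) (h : IsInAdd S V W) :
    Module.Finite S W := by
  obtain ⟨k, i, p, h⟩ := h
  exact Module.Finite.of_surjective p fun w => ⟨i w, LinearMap.congr_fun h w⟩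

end IsInAdd

theorem IsFGProjective.prod {P Q : ModuleCat.{u} S} (hP : IsFGProjective S P)
    (hQ : IsFGProjective S Q) : IsFGProjective S (ModuleCat.of S (P × Q)) := by
  obtain ⟨h1, h2⟩ := hP
  obtain ⟨h3, h4⟩ := hQ
  exact ⟨inferInstanceAs (Module.Finite S (P × Q)), inferInstanceAs (Module.Projective S (P × Q))⟩

theorem IsFGProjective.punit : IsFGProjective S (ModuleCat.of S PUnit.{u + 1}) :=
  ⟨inferInstanceAs (Module.Finite S PUnit.{u + 1}),
    inferInstanceAs (Module.Projective S PUnit.{u + 1})⟩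

theorem exists_isInAdd_pair {V W : ModuleCat.{u} S} (hV : Module.Finite S V)
    (hW : Module.Finite S W) :
    ∃ U : ModuleCat.{u} S, Module.Finite S U ∧ IsInAdd S U V ∧ IsInAdd S U W :=
  ⟨ModuleCat.of S (V × W), inferInstanceAs (Module.Finite S (V × W)), .left V W, .right V W⟩

/-- The syzygies of the modules in `add V` lie in `add U` for some finitely generated `U`, whose
additive closure also contains the projective modules. -/
theorem exists_syzygy_isInAdd [IsNoetherianRing S] {V : ModuleCat.{u} S}
    (hV : Module.Finite S V) :
    ∃ U : ModuleCat.{u} S, Module.Finite S U ∧ IsInAdd S U (ModuleCat.of S S) ∧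
      ∀ K P W : ModuleCat.{u} S, IsInAdd S V W → IsFGProjective S P → SES S K P W →
        IsInAdd S U K := by
  obtain ⟨L, Q, ⟨hQ1, hQ2⟩, hL⟩ := SES.exists_cover (S := S) V
  have hLf : Module.Finite S L := hL.finite_left
  refine ⟨ModuleCat.of S (L × S), inferInstanceAs (Module.Finite S (L × S)),
    IsInAdd.right L (ModuleCat.of S S), fun K P W hW hP hK => ?_⟩
  obtain ⟨k, i, p, hip⟩ := isInAdd_iff.1 hW
  obtain ⟨l, q, hl, hlq, hq⟩ := hL
  obtain ⟨j, r, hj, hjr, hr⟩ := hK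
  have hP2 := hP.2
  -- A map killed by `q` (or by `r`, in `liftK`) factors through the kernel; linearity follows from
  -- injectivity of the inclusion.
  have liftL : ∀ {X : ModuleCat.{u} S} (f : X →ₗ[S] Q), (∀ x, q (f x) = 0) →
      ∃ g : X →ₗ[S] L, ∀ x, l (g x) = f x := fun f hf => by
    choose g hg using fun x => (hlq _).1 (hf x)
    exact ⟨⟨⟨g, fun x y => hl (by simp [hg])⟩, fun c x => hl (by simp [hg])⟩, hg⟩
  have liftK : ∀ {X : ModuleCat.{u} S} (f : X →ₗ[S] P), (∀ x, r (f x) = 0) →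
      ∃ g : X →ₗ[S] K, ∀ x, j (g x) = f x := fun f hf => by
    choose g hg using fun x => (hjr _).1 (hf x)
    exact ⟨⟨⟨g, fun x y => hj (by simp [hg])⟩, fun c x => hj (by simp [hg])⟩, hg⟩
  -- A Schanuel-type comparison: `i c` and `p c` lift to the projectives as `a c` and `b c`, which
  -- restrict to maps `a' c : K → L` and `b' c : L → K`.
  choose a ha using fun c => Module.projective_lifting_property q (i c ∘ₗ r) hq
  choose b hb using fun c => Module.projective_lifting_property r (p c ∘ₗ q) hr
  have ha' : ∀ c x, q (a c x) = i c (r x) := fun c x => LinearMap.congr_fun (ha c) x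
  have hb' : ∀ c x, r (b c x) = p c (q x) := fun c x => LinearMap.congr_fun (hb c) x
  have hrj : ∀ x, r (j x) = 0 := fun x => (hjr _).2 ⟨x, rfl⟩
  have hql : ∀ x, q (l x) = 0 := fun x => (hlq _).2 ⟨x, rfl⟩
  choose a' ha'' using fun c => liftL (a c ∘ₗ j) fun x => by simp [ha', hrj]
  choose b' hb'' using fun c => liftK (b c ∘ₗ l) fun x => by simp [hb', hql]
  -- The lifts need not compose to the identity of `P`, but the error dies in `W` and so lands in
  -- `K`. Recording it through `θ` makes `K` a retract of `L^k × P`.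
  obtain ⟨θ, hθ⟩ := liftK (LinearMap.id - ∑ c, b c ∘ₗ a c) fun x => by
    simp [ha', hb', hip]
  have hKP : IsInAdd S (ModuleCat.of S ((Fin k → L) × P)) K := by
    refine IsInAdd.of_retract ((LinearMap.pi a').prod j)
      ((∑ c, b' c ∘ₗ LinearMap.proj c).coprod θ) fun x => hj ?_
    simp [hθ, hb'', ha'']
  refine hKP.trans (IsInAdd.prod (W := ModuleCat.of S (Fin k → L)) ?_
    ((IsInAdd.of_isFGProjective hP).trans (IsInAdd.right L (ModuleCat.of S S))))
  exact IsInAdd.trans ⟨k, LinearMap.id, LinearMap.id, rfl⟩ (IsInAdd.left L (ModuleCat.of S S))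

end Add

/-! ### Syzygies and extensions of `add`-resolutions, with one module serving all cases. -/

section Resolution

variable {S : Type u} [Ring S]

/-- There is an exact sequence `0 → V_{n-1} → ⋯ → V_0 → X → 0` with all `V_i ∈ add V`. -/
abbrev AddResolution (V : ModuleCat.{u} S) (n : ℕ) (X : ModuleCat.{u} S) : Prop :=
  Chain (IsInAdd S V) n (ModuleCat.of S PUnit.{u + 1}) X

namespace AddResolution

variable {V W U X Y Z : ModuleCat.{u} S}

theorem mono {n : ℕ} (h : AddResolution V n X) (hU : IsInAdd S U V) : AddResolution U n X :=
  Chain.mono (fun _ hC => hC.trans hU) h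

theorem subsingleton (h : AddResolution V 0 X) : Subsingleton X := by
  obtain ⟨e⟩ := h
  exact e.symm.toEquiv.subsingleton

theorem of_subsingleton (X : ModuleCat.{u} S) [Subsingleton X] : AddResolution V 0 X :=
  ⟨{ toFun := 0, invFun := 0, map_add' := by simp, map_smul' := by simp,
     left_inv := fun _ => Subsingleton.elim _ _, right_inv := fun _ => Subsingleton.elim _ _ }⟩

theorem one_iff : AddResolution V 1 X ↔ IsInAdd S V X := by
  constructor
  · rintro ⟨C, Y, hC, hs, h⟩
    have := subsingleton h
    obtain ⟨e⟩ := hs.exists_equiv_right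
    exact (IsInAdd.of_equiv e).trans hC
  · intro h
    exact ⟨X, ModuleCat.of S PUnit.{u + 1}, h, .of_subsingleton_left (LinearEquiv.refl S X),
      of_subsingleton _⟩

theorem finite {n : ℕ} (hV : Module.Finite S V) (h : AddResolution V n X) :
    Module.Finite S X := by
  cases n with
  | zero =>
    have := subsingleton h
    infer_instance
  | succ n =>
    obtain ⟨C, Y, hC, hs, -⟩ := h
    have := hC.finite hV
    exact hs.finite_right

theorem prod {n : ℕ} (h : AddResolution V (n + 1) X) (hZ : IsInAdd S V Z) :
    AddResolution V (n + 1) (ModuleCat.of S (X × Z)) := by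
  obtain ⟨C, Y, hC, hs, h⟩ := h
  exact ⟨ModuleCat.of S (C × Z), Y, hC.prod hZ, hs.prod_right, h⟩

variable [IsNoetherianRing S]

/-- A horseshoe argument shows that passing to a suitable syzygy does not lengthen a resolution. The
quantifier order matters here and below: `U` must not depend on `X`, as the Igusa–Todorov condition
asks for a single module. -/
theorem exists_syzygy (n : ℕ) (hV : Module.Finite S V) :
    ∃ U : ModuleCat.{u} S, Module.Finite S U ∧ ∀ X : ModuleCat.{u} S, AddResolution V n X →
      ∃ K P : ModuleCat.{u} S, IsFGProjective S P ∧ SES S K P X ∧ AddResolution U n K := by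
  obtain ⟨U, hU, hSU, hsyz⟩ := exists_syzygy_isInAdd hV
  refine ⟨U, hU, fun X h => ?_⟩
  induction n generalizing X with
  | zero =>
    have := subsingleton h
    exact ⟨ModuleCat.of S PUnit.{u + 1}, ModuleCat.of S PUnit.{u + 1}, .punit,
      .of_subsingleton_right (LinearEquiv.refl S _), of_subsingleton _⟩
  | succ n ih =>
    obtain ⟨C, Y, hC, hs, h⟩ := h
    obtain ⟨K, P, hP, hK, hKres⟩ := ih Y h
    have := hC.finite hV
    obtain ⟨L, Q, hQ, hL⟩ := SES.exists_cover (S := S) C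
    -- The kernel `T` of `Q → C → X` is an extension of `Y` by `L`; rotating it along `P → Y`
    -- exhibits `T` as `L × P` modulo `K`.
    obtain ⟨T, hT, hT'⟩ := hL.comp hs
    have := hP.2
    exact ⟨T, Q, hQ, hT, ModuleCat.of S (L × P), K,
      (hsyz L Q C hC hQ hL).prod ((IsInAdd.of_isFGProjective hP).trans hSU), hT'.rotate hK,
      hKres⟩

/-- With `P` projective onto `Z`, the map `X × P → Y` is onto with kernel a syzygy of `Z`. Composing
it with `C × P → X × P` leaves a kernel `T` that is again such an extension, with a shorter left
end. -/
theorem exists_extension_of_isInAdd (n : ℕ) (hV : Module.Finite S V) (hW : Module.Finite S W) :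
    ∃ U : ModuleCat.{u} S, Module.Finite S U ∧ ∀ X Y Z : ModuleCat.{u} S, SES S X Y Z →
      AddResolution V n X → IsInAdd S W Z → AddResolution U (n + 1) Y := by
  induction n generalizing W with
  | zero =>
    refine ⟨W, hW, fun X Y Z hs hX hZ => ?_⟩
    have := subsingleton hX
    obtain ⟨e⟩ := hs.exists_equiv_right
    exact one_iff.2 ((IsInAdd.of_equiv e.symm).trans hZ)
  | succ n ih =>
    obtain ⟨W', hW', hSW', hsyz⟩ := exists_syzygy_isInAdd hW
    obtain ⟨U, hU, hext⟩ := ih hW'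
    obtain ⟨U₁, hU₁, hUV, hUW⟩ := exists_isInAdd_pair hV hW'
    obtain ⟨U₂, hU₂, hUU, hUU₁⟩ := exists_isInAdd_pair hU hU₁
    refine ⟨U₂, hU₂, fun X Y Z hs hX hZ => ?_⟩
    obtain ⟨C, X', hC, hX', hres⟩ := hX
    have := hZ.finite hW
    obtain ⟨K, P, hP, hK⟩ := SES.exists_cover (S := S) Z
    have := hP.2
    obtain ⟨T, hT, hT'⟩ := (hX'.prod_right (P := P)).comp (hs.rotate hK)
    refine ⟨ModuleCat.of S (C × P), T, ?_, hT,
      (hext X' T K hT' hres (hsyz K P Z hZ hP hK)).mono hUU⟩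
    exact (hC.trans (hUV.trans hUU₁)).prod
      ((IsInAdd.of_isFGProjective hP).trans (hSW'.trans (hUW.trans hUU₁)))

/-- Induction on the resolution of `Z`. Removing one of its terms lengthens the resolution of the
left end by one and adds one projective term in front of `Y`; hence the factor `2` at `m`. -/
theorem exists_extension (m n : ℕ) (hV : Module.Finite S V) (hW : Module.Finite S W) :
    ∃ U : ModuleCat.{u} S, Module.Finite S U ∧ ∀ X Y Z : ModuleCat.{u} S, SES S X Y Z →
      AddResolution V n X → AddResolution W (m + 1) Z → AddResolution U (2 * m + n + 1) Y := by
  induction m generalizing n V W with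
  | zero =>
    obtain ⟨U, hU, h⟩ := exists_extension_of_isInAdd n hV hW
    refine ⟨U, hU, fun X Y Z hs hX hZ => ?_⟩
    rw [Nat.mul_zero, Nat.zero_add]
    exact h X Y Z hs hX (one_iff.1 hZ)
  | succ m ih =>
    obtain ⟨U₁, hU₁, hext₁⟩ := exists_extension_of_isInAdd n hV hW
    obtain ⟨U₂, hU₂, hsyz⟩ := exists_syzygy (n + 1) hU₁
    obtain ⟨W', hW', hWW', hSW'⟩ := exists_isInAdd_pair hW (W := ModuleCat.of S S)
      (inferInstanceAs (Module.Finite S (ModuleCat.of S S)))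
    obtain ⟨U₃, hU₃, hext⟩ := ih (n + 1) hU₂ hW'
    obtain ⟨U, hU, hUU₃, hSU⟩ := exists_isInAdd_pair hU₃ (W := ModuleCat.of S S)
      (inferInstanceAs (Module.Finite S (ModuleCat.of S S)))
    refine ⟨U, hU, fun X Y Z hs hX hZ => ?_⟩
    have hXf := finite hV hX
    have hZf := finite hW hZ
    have hYf := hs.finite_middle
    obtain ⟨C, Z', hC, hZ', hres⟩ := hZ
    -- The pullback `T` of `Y → Z ← C` is an extension of `C` by `X`, so it has `n + 1` terms, and
    -- it maps onto `Y` with kernel `Z'`.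
    obtain ⟨T, hT, hT'⟩ := hs.pullback hZ'
    obtain ⟨K, P, hP, hK, hKres⟩ := hsyz T (hext₁ X T C hT hX hC)
    obtain ⟨L, Q, hQ, hL⟩ := SES.exists_cover (S := S) Y
    have := hP.2
    have := hQ.2
    -- Two rotations yield `0 → K → L × P → Z' × Q → 0`, where `L` and `K` are syzygies of `Y` and
    -- `T`. The right end now has a shorter resolution, so the induction hypothesis applies to `L ×
    -- P`.
    have h1 := (hT'.rotate hL).rotate hK
    have h2 := hext K (ModuleCat.of S (L × P)) (ModuleCat.of S (Z' × Q)) h1 hKres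
      ((AddResolution.mono hres hWW').prod ((IsInAdd.of_isFGProjective hQ).trans hSW'))
    have h3 : AddResolution U (2 * m + (n + 1) + 1 + 1) Y :=
      ⟨ModuleCat.of S (Q × P), ModuleCat.of S (L × P),
        (IsInAdd.of_isFGProjective (hQ.prod hP)).trans hSU, hL.prod_left, h2.mono hUU₃⟩
    have h4 : 2 * (m + 1) + n + 1 = 2 * m + (n + 1) + 1 + 1 := by ring
    rw [h4]
    exact h3

end AddResolution

end Resolution

/-! ### Functoriality and exactness of the balanced tensor product -/

/-- The balanced tensor product `Y ⊗_B L` as a type of its own. -/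
def BTensor (B Y L : Type u) [Ring B] [AddCommGroup Y] [Module Bᵐᵒᵖ Y]
    [AddCommGroup L] [Module B L] : Type u :=
  BalancedTensor B Y L

namespace BTensor

section Basic

variable {B Y Y' L : Type u} [Ring B] [AddCommGroup Y] [Module Bᵐᵒᵖ Y] [AddCommGroup Y']
  [Module Bᵐᵒᵖ Y'] [AddCommGroup L] [Module B L]

instance : AddCommGroup (BTensor B Y L) :=
  inferInstanceAs (AddCommGroup (BalancedTensor B Y L))

/-- The element `y ⊗ l` of `Y ⊗_B L`. -/
def tmul (B : Type u) {Y L : Type u} [Ring B] [AddCommGroup Y] [Module Bᵐᵒᵖ Y]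
    [AddCommGroup L] [Module B L] (y : Y) (l : L) : BTensor B Y L :=
  Submodule.Quotient.mk (p := Submodule.span ℤ {z : Y ⊗[ℤ] L | ∃ (n : Y) (b : B) (m : L),
      z = (MulOpposite.op b • n) ⊗ₜ[ℤ] m - n ⊗ₜ[ℤ] (b • m)}) (y ⊗ₜ[ℤ] l)

theorem tmul_add (y : Y) (l l' : L) : tmul B y (l + l') = tmul B y l + tmul B y l' := by
  unfold tmul
  rw [TensorProduct.tmul_add]
  exact Submodule.Quotient.mk_add _

theorem add_tmul (y y' : Y) (l : L) : tmul B (y + y') l = tmul B y l + tmul B y' l := by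
  unfold tmul
  rw [TensorProduct.add_tmul]
  exact Submodule.Quotient.mk_add _

theorem smul_tmul (y : Y) (b : B) (l : L) :
    tmul B (MulOpposite.op b • y) l = tmul B y (b • l) :=
  (Submodule.Quotient.eq _).2 (Submodule.subset_span ⟨y, b, l, rfl⟩)

/-- Tensoring with a fixed right factor. -/
def tmulRight (B : Type u) {Y L : Type u} [Ring B] [AddCommGroup Y] [Module Bᵐᵒᵖ Y]
    [AddCommGroup L] [Module B L] (l : L) : Y →+ BTensor B Y L :=
  AddMonoidHom.mk' (fun y => tmul B y l) fun y y' => add_tmul y y' l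

/-- Tensoring with a fixed left factor. -/
def tmulLeft (B : Type u) {Y L : Type u} [Ring B] [AddCommGroup Y] [Module Bᵐᵒᵖ Y]
    [AddCommGroup L] [Module B L] (y : Y) : L →+ BTensor B Y L :=
  AddMonoidHom.mk' (fun l => tmul B y l) fun l l' => tmul_add y l l'

theorem zero_tmul (l : L) : tmul B (0 : Y) l = 0 := (tmulRight B l).map_zero

theorem tmul_zero (y : Y) : tmul B y (0 : L) = 0 := (tmulLeft B y).map_zero

theorem sum_tmul {ι : Type*} (s : Finset ι) (y : ι → Y) (l : L) :
    tmul B (∑ j ∈ s, y j) l = ∑ j ∈ s, tmul B (y j) l := map_sum (tmulRight B l) y s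

theorem tmul_sum {ι : Type*} (s : Finset ι) (y : Y) (l : ι → L) :
    tmul B y (∑ j ∈ s, l j) = ∑ j ∈ s, tmul B y (l j) := map_sum (tmulLeft B y) l s

@[elab_as_elim]
theorem induction_on {p : BTensor B Y L → Prop} (z : BTensor B Y L)
    (tmul : ∀ y l, p (tmul B y l)) (add : ∀ z z', p z → p z' → p (z + z')) : p z := by
  obtain ⟨t, rfl⟩ := Submodule.Quotient.mk_surjective _ z
  induction t with
  | zero =>
    have h := tmul 0 0
    rw [zero_tmul] at h
    exact h
  | tmul y l => exact tmul y l
  | add t t' h h' => exact add _ _ h h'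

theorem addHom_ext {Z : Type*} [AddCommGroup Z] {f g : BTensor B Y L →+ Z}
    (h : ∀ y l, f (tmul B y l) = g (tmul B y l)) : f = g := by
  ext z
  induction z using induction_on with
  | tmul y l => exact h y l
  | add z z' h h' => rw [map_add, map_add, h, h']

/-- The universal property of the balanced tensor product. -/
def lift {Z : Type*} [AddCommGroup Z] (f : Y →+ L →+ Z)
    (h : ∀ y (b : B) l, f (MulOpposite.op b • y) l = f y (b • l)) : BTensor B Y L →+ Z :=
  (Submodule.liftQ _ (TensorProduct.liftAddHom f fun r y l => by simp).toIntLinearMap (by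
    rw [Submodule.span_le]
    rintro _ ⟨y, b, l, rfl⟩
    simp [h])).toAddMonoidHom

@[simp]
theorem lift_tmul {Z : Type*} [AddCommGroup Z] (f : Y →+ L →+ Z)
    (h : ∀ y (b : B) l, f (MulOpposite.op b • y) l = f y (b • l)) (y : Y) (l : L) :
    lift f h (tmul B y l) = f y l := rfl

/-- The map on balanced tensor products induced by maps of both factors. -/
def mapHom {L' : Type u} [AddCommGroup L'] [Module B L'] (f : Y →ₗ[Bᵐᵒᵖ] Y') (g : L →ₗ[B] L') :
    BTensor B Y L →+ BTensor B Y' L' :=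
  lift (AddMonoidHom.mk' (fun y => (tmulLeft B (f y)).comp g.toAddMonoidHom) fun y y' => by
    ext l; simp [tmulLeft, add_tmul]) fun y b l => by simp [tmulLeft, smul_tmul]

@[simp]
theorem mapHom_tmul {L' : Type u} [AddCommGroup L'] [Module B L'] (f : Y →ₗ[Bᵐᵒᵖ] Y')
    (g : L →ₗ[B] L') (y : Y) (l : L) : mapHom f g (tmul B y l) = tmul B (f y) (g l) := rfl

end Basic

section Bimodule

variable {B T Y Y' Y'' L : Type u} [Ring B] [Ring T] [AddCommGroup Y] [Module Bᵐᵒᵖ Y]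
  [AddCommGroup Y'] [Module Bᵐᵒᵖ Y'] [AddCommGroup Y''] [Module Bᵐᵒᵖ Y''] [AddCommGroup L]
  [Module B L] [Module T L] [SMulCommClass B T L]

/-- The action of `t` on `Y ⊗_B L` through `L`. -/
def smulHom (t : T) : BTensor B Y L →+ BTensor B Y L :=
  mapHom LinearMap.id
    { toFun := fun l => t • l, map_add' := smul_add t,
      map_smul' := fun b l => (smul_comm b t l).symm }

instance : Module T (BTensor B Y L) where
  smul t := smulHom t
  one_smul z := DFunLike.congr_fun (addHom_ext (f := smulHom (1 : T)) (g := AddMonoidHom.id _)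
    fun y l => congrArg (tmul B y) (one_smul T l)) z
  mul_smul s t z := DFunLike.congr_fun (addHom_ext (f := smulHom (s * t))
    (g := (smulHom s).comp (smulHom t)) fun y l => congrArg (tmul B y) (mul_smul s t l)) z
  smul_zero t := map_zero (smulHom t)
  smul_add t := map_add (smulHom t)
  add_smul s t z := DFunLike.congr_fun (addHom_ext (f := smulHom (s + t))
    (g := smulHom s + smulHom t) fun y l =>
      (congrArg (tmul B y) (add_smul s t l)).trans (tmul_add y _ _)) z
  zero_smul z := DFunLike.congr_fun (addHom_ext (f := smulHom (0 : T))
    (g := (0 : BTensor B Y L →+ BTensor B Y L)) fun y l =>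
      (congrArg (tmul B y) (zero_smul T l)).trans (tmul_zero y)) z

@[simp]
theorem smul_tmul_right (t : T) (y : Y) (l : L) : t • tmul B y l = tmul B y (t • l) := rfl

/-- The functor `- ⊗_B L` on linear maps. -/
def map (T L : Type u) [Ring T] [AddCommGroup L] [Module B L] [Module T L] [SMulCommClass B T L]
    (f : Y →ₗ[Bᵐᵒᵖ] Y') : BTensor B Y L →ₗ[T] BTensor B Y' L where
  toFun := mapHom f LinearMap.id
  map_add' := map_add _
  map_smul' t z := by
    induction z using induction_on with
    | tmul y l => rfl
    | add z z' h h' => rw [smul_add, map_add, map_add, h, h']; exact (smul_add _ _ _).symm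

theorem linearMap_ext {Z : Type*} [AddCommGroup Z] [Module T Z] {f g : BTensor B Y L →ₗ[T] Z}
    (h : ∀ y l, f (tmul B y l) = g (tmul B y l)) : f = g :=
  LinearMap.toAddMonoidHom_injective (addHom_ext h)

theorem map_id : map T L (LinearMap.id : Y →ₗ[Bᵐᵒᵖ] Y) = LinearMap.id :=
  linearMap_ext fun _ _ => rfl

theorem map_comp (g : Y' →ₗ[Bᵐᵒᵖ] Y'') (f : Y →ₗ[Bᵐᵒᵖ] Y') :
    map T L (g ∘ₗ f) = map T L g ∘ₗ map T L f :=
  linearMap_ext fun _ _ => rfl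

theorem map_add (f g : Y →ₗ[Bᵐᵒᵖ] Y') : map T L (f + g) = map T L f + map T L g :=
  linearMap_ext fun y l => add_tmul (f y) (g y) l

theorem map_zero : map T L (0 : Y →ₗ[Bᵐᵒᵖ] Y') = 0 :=
  linearMap_ext fun _ l => zero_tmul l

/-- For a projective left module `L`, the functor `- ⊗_B L` is naturally a retract of a direct sum
of copies of the identity. -/
theorem exists_retract (B L : Type u) [Ring B] [AddCommGroup L] [Module B L]
    [Module.Projective B L] :
    ∃ (Φ : ∀ (Y : Type u) [AddCommGroup Y] [Module Bᵐᵒᵖ Y], BTensor B Y L →+ (L →₀ Y))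
      (Ψ : ∀ (Y : Type u) [AddCommGroup Y] [Module Bᵐᵒᵖ Y], (L →₀ Y) →+ BTensor B Y L),
      (∀ (Y : Type u) [AddCommGroup Y] [Module Bᵐᵒᵖ Y] (z), Ψ Y (Φ Y z) = z) ∧
      (∀ (Y Y' : Type u) [AddCommGroup Y] [Module Bᵐᵒᵖ Y] [AddCommGroup Y'] [Module Bᵐᵒᵖ Y']
        (f : Y →ₗ[Bᵐᵒᵖ] Y') (z), Φ Y' (mapHom f LinearMap.id z) =
          Finsupp.mapRange.addMonoidHom f.toAddMonoidHom (Φ Y z)) ∧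
      (∀ (Y Y' : Type u) [AddCommGroup Y] [Module Bᵐᵒᵖ Y] [AddCommGroup Y'] [Module Bᵐᵒᵖ Y']
        (f : Y →ₗ[Bᵐᵒᵖ] Y') (z), Ψ Y' (Finsupp.mapRange.addMonoidHom f.toAddMonoidHom z) =
          mapHom f LinearMap.id (Ψ Y z)) := by
  obtain ⟨s, hs⟩ := Module.projective_def.1 (inferInstance : Module.Projective B L)
  -- The section `s` acts as a dual basis: `Φ` sends `y ⊗ l` to the family `j ↦ y · s(l)_j`, and `Ψ`
  -- sends a family `(y_j)` to `∑ y_j ⊗ j`.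
  let act : ∀ (Y : Type u) [AddCommGroup Y] [Module Bᵐᵒᵖ Y], Y → (B →+ Y) := fun Y _ _ y =>
    AddMonoidHom.mk' (fun b => MulOpposite.op b • y) fun b b' => by
      rw [MulOpposite.op_add, add_smul]
  refine ⟨fun Y _ _ => lift (AddMonoidHom.mk'
      (fun y => (Finsupp.mapRange.addMonoidHom (act Y y)).comp s.toAddMonoidHom) ?_) ?_,
    fun Y _ _ => Finsupp.liftAddHom fun l => tmulRight B l, ?_, ?_, ?_⟩
  · intro y y'
    ext l j
    simp [act]
  · intro y b l
    ext j
    simp [act, mul_smul]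
  · intro Y _ _ z
    induction z using induction_on with
    | tmul y l =>
      rw [lift_tmul]
      conv_rhs => rw [← hs l, Finsupp.linearCombination_apply, Finsupp.sum, tmul_sum]
      change Finsupp.sum (Finsupp.mapRange (act Y y) (_root_.map_zero _) (s l)) _ = _
      rw [Finsupp.sum_mapRange_index (fun a => (tmulRight B a).map_zero), Finsupp.sum]
      exact Finset.sum_congr rfl fun j _ => smul_tmul y _ j
    | add z z' h h' => rw [_root_.map_add, _root_.map_add, h, h']
  · intro Y Y' _ _ _ _ f z
    induction z using induction_on with
    | tmul y l =>
      ext j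
      simp [act]
    | add z z' h h' => simp only [_root_.map_add, h, h']
  · intro Y Y' _ _ _ _ f z
    induction z using Finsupp.induction_linear with
    | zero => simp
    | add z z' h h' => simp only [_root_.map_add, h, h']
    | single l y => simp [tmulRight, Finsupp.sum_single_index, zero_tmul]

/-- By the natural retraction, it suffices to argue coordinatewise on finitely supported families;
`map_exact` uses the same reduction. -/
theorem map_injective [Module.Projective B L] {f : Y →ₗ[Bᵐᵒᵖ] Y'} (hf : Function.Injective f) :
    Function.Injective (map T L f) := by
  obtain ⟨Φ, Ψ, hΨΦ, hΦ, -⟩ := exists_retract B L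
  refine (injective_iff_map_eq_zero _).2 fun z hz => ?_
  have h1 := hΦ Y Y' f z
  have hz' : mapHom f LinearMap.id z = 0 := hz
  rw [hz', _root_.map_zero] at h1
  have h2 : Φ Y z = 0 := by
    ext j
    refine hf ?_
    simpa using (DFunLike.congr_fun h1 j).symm
  rw [← hΨΦ Y z, h2, _root_.map_zero]

theorem map_surjective {f : Y →ₗ[Bᵐᵒᵖ] Y'} (hf : Function.Surjective f) :
    Function.Surjective (map T L f) := by
  intro z
  induction z using induction_on with
  | tmul y l =>
    obtain ⟨x, rfl⟩ := hf y
    exact ⟨tmul B x l, rfl⟩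
  | add z z' h h' =>
    obtain ⟨x, rfl⟩ := h
    obtain ⟨x', rfl⟩ := h'
    exact ⟨x + x', _root_.map_add _ _ _⟩

theorem map_exact [Module.Projective B L] {f : Y →ₗ[Bᵐᵒᵖ] Y'} {g : Y' →ₗ[Bᵐᵒᵖ] Y''}
    (h : Function.Exact f g) : Function.Exact (map T L f) (map T L g) := by
  obtain ⟨Φ, Ψ, hΨΦ, hΦ, hΨ⟩ := exists_retract B L
  intro z
  constructor
  · intro hz
    have h1 := hΦ Y' Y'' g z
    have hz' : mapHom g LinearMap.id z = 0 := hz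
    rw [hz', _root_.map_zero] at h1
    have h2 : ∀ j, ∃ y, f y = Φ Y' z j := fun j => (h _).1 (by
      simpa using (DFunLike.congr_fun h1 j).symm)
    have h3 : ∃ c : L →₀ Y, Finsupp.mapRange.addMonoidHom f.toAddMonoidHom c = Φ Y' z := by
      generalize Φ Y' z = w at h2
      choose y hy using h2
      -- Chosen preimages are used only on the support, since the one chosen for `0` need not
      -- vanish.
      refine ⟨∑ j ∈ w.support, Finsupp.single j (y j), ?_⟩
      rw [map_sum]
      conv_rhs => rw [← Finsupp.sum_single w, Finsupp.sum]
      exact Finset.sum_congr rfl fun j _ => by simp [hy]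
    obtain ⟨c, hc⟩ := h3
    refine ⟨Ψ Y c, ?_⟩
    rw [← hΨΦ Y' z, ← hc]
    exact (hΨ Y Y' f c).symm
  · rintro ⟨x, rfl⟩
    rw [← LinearMap.comp_apply, ← map_comp, h.linearMap_comp_eq_zero, map_zero,
      LinearMap.zero_apply]

theorem map_SES [Module.Projective B L] (h : SES Bᵐᵒᵖ Y Y' Y'') :
    SES T (BTensor B Y L) (BTensor B Y' L) (BTensor B Y'' L) := by
  obtain ⟨i, p, hi, hip, hp⟩ := h
  exact ⟨map T L i, map T L p, map_injective hi, map_exact hip, map_surjective hp⟩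

/-- The functor `- ⊗_B L` on linear equivalences. -/
def congr (T L : Type u) [Ring T] [AddCommGroup L] [Module B L] [Module T L] [SMulCommClass B T L]
    (e : Y ≃ₗ[Bᵐᵒᵖ] Y') : BTensor B Y L ≃ₗ[T] BTensor B Y' L :=
  LinearEquiv.ofLinearMap (map T L e.toLinearMap) (map T L e.symm.toLinearMap)
    (by rw [← map_comp, LinearEquiv.comp_symm, map_id])
    (by rw [← map_comp, LinearEquiv.symm_comp, map_id])

end Bimodule

end BTensor

/-! ### Right modules over the Morita context ring -/

theorem IsInAdd.map {S R : Type u} [Ring S] [Ring R] {T : ModuleCat.{u} S → ModuleCat.{u} R}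
    (F : ∀ X Y : ModuleCat.{u} S, (X →ₗ[S] Y) → (T X →ₗ[R] T Y))
    (hid : ∀ X, F X X LinearMap.id = LinearMap.id)
    (hcomp : ∀ (X Y Z : ModuleCat.{u} S) (g : Y →ₗ[S] Z) (f : X →ₗ[S] Y),
      F X Z (g ∘ₗ f) = F Y Z g ∘ₗ F X Y f)
    (hadd : ∀ (X Y : ModuleCat.{u} S) (f g : X →ₗ[S] Y), F X Y (f + g) = F X Y f + F X Y g)
    {V W : ModuleCat.{u} S} (h : IsInAdd S V W) : IsInAdd R (T V) (T W) := by
  obtain ⟨k, i, p, h⟩ := isInAdd_iff.1 h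
  refine isInAdd_iff.2 ⟨k, fun j => F _ _ (i j), fun j => F _ _ (p j), fun w => ?_⟩
  have h1 : ∑ j, p j ∘ₗ i j = LinearMap.id := LinearMap.ext fun w => by simpa using h w
  have h2 := map_sum (AddMonoidHom.mk' (F W W) (hadd W W)) (fun j => p j ∘ₗ i j) Finset.univ
  rw [h1] at h2
  have h3 : LinearMap.id = ∑ j, F V W (p j) ∘ₗ F W V (i j) := by
    rw [← hid W]
    exact h2.trans (Finset.sum_congr rfl fun j _ => hcomp _ _ _ _ _)
  simpa using (LinearMap.congr_fun h3 w).symm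

instance Module.Projective.pi_of_fintype {S : Type*} [Ring S] {ι : Type*} [Fintype ι] (X : ι → Type*)
    [∀ j, AddCommGroup (X j)] [∀ j, Module S (X j)] [∀ j, Module.Projective S (X j)] :
    Module.Projective S (∀ j, X j) := by
  classical
  exact Module.Projective.of_equiv (DFinsupp.linearEquivFunOnFintype (R := S) (M := X))

set_option linter.unusedSectionVars false

namespace MoritaRing

variable {A N M B : Type u} [Ring A] [Ring B] [AddCommGroup N] [AddCommGroup M]
  [Module A N] [Module Bᵐᵒᵖ N] [Module B M] [Module Aᵐᵒᵖ M] [SMulCommClass A Bᵐᵒᵖ N]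
  [SMulCommClass B Aᵐᵒᵖ M]

variable (A N M B) in
/-- The ring whose modules are the right modules over the Morita context ring. -/
abbrev Op : Type u := (MoritaRing A N M B)ᵐᵒᵖ

variable (A N M) in
/-- The element with single nonzero entry `b ∈ B`. -/
def ofB (b : B) : MoritaRing A N M B := ⟨0, 0, 0, b⟩

variable (N M B) in
/-- The element with single nonzero entry `a ∈ A`. -/
def ofA (a : A) : MoritaRing A N M B := ⟨a, 0, 0, 0⟩

@[simp] theorem ofB_a (b : B) : (ofB A N M b).a = 0 := rfl
@[simp] theorem ofB_n (b : B) : (ofB A N M b).n = 0 := rfl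
@[simp] theorem ofB_m (b : B) : (ofB A N M b).m = 0 := rfl
@[simp] theorem ofB_b (b : B) : (ofB A N M b).b = b := rfl
@[simp] theorem ofA_a (a : A) : (ofA N M B a).a = a := rfl
@[simp] theorem ofA_n (a : A) : (ofA N M B a).n = 0 := rfl
@[simp] theorem ofA_m (a : A) : (ofA N M B a).m = 0 := rfl
@[simp] theorem ofA_b (a : A) : (ofA N M B a).b = 0 := rfl

theorem ofB_mul (b b' : B) : ofB A N M (b * b') = ofB A N M b * ofB A N M b' := by
  ext <;> simp

theorem ofB_add (b b' : B) : ofB A N M (b + b') = ofB A N M b + ofB A N M b' := by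
  ext <;> simp

theorem ofB_zero : ofB A N M (0 : B) = 0 := rfl

theorem ofA_mul (a a' : A) : ofA N M B (a * a') = ofA N M B a * ofA N M B a' := by
  ext <;> simp

theorem ofA_add (a a' : A) : ofA N M B (a + a') = ofA N M B a + ofA N M B a' := by
  ext <;> simp

/-! #### The second row `(M, B)` -/

/-- The bimodule `(M, B)`, the second row of the Morita context ring. -/
@[ext]
structure Row (M B : Type u) : Type u where
  m : M
  b : B

namespace Row

instance : Zero (Row M B) := ⟨⟨0, 0⟩⟩
instance : Add (Row M B) := ⟨fun l l' => ⟨l.m + l'.m, l.b + l'.b⟩⟩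
instance : Neg (Row M B) := ⟨fun l => ⟨-l.m, -l.b⟩⟩
instance : SMul B (Row M B) := ⟨fun b l => ⟨b • l.m, b * l.b⟩⟩

@[simp] theorem add_m (l l' : Row M B) : (l + l').m = l.m + l'.m := rfl
@[simp] theorem add_b (l l' : Row M B) : (l + l').b = l.b + l'.b := rfl
@[simp] theorem zero_m : (0 : Row M B).m = 0 := rfl
@[simp] theorem zero_b : (0 : Row M B).b = 0 := rfl
@[simp] theorem neg_m (l : Row M B) : (-l).m = -l.m := rfl
@[simp] theorem neg_b (l : Row M B) : (-l).b = -l.b := rfl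
@[simp] theorem smul_m (b : B) (l : Row M B) : (b • l).m = b • l.m := rfl
@[simp] theorem smul_b (b : B) (l : Row M B) : (b • l).b = b * l.b := rfl

instance : AddCommGroup (Row M B) where
  add_assoc x y z := by ext <;> simp [add_assoc]
  zero_add x := by ext <;> simp
  add_zero x := by ext <;> simp
  add_comm x y := by ext <;> simp [add_comm]
  neg_add_cancel x := by ext <;> simp
  nsmul := nsmulRec
  zsmul := zsmulRec

instance : Module B (Row M B) where
  one_smul l := by ext <;> simp
  mul_smul b b' l := by ext <;> simp [mul_smul, mul_assoc]
  smul_zero b := by ext <;> simp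
  smul_add b l l' := by ext <;> simp [mul_add]
  add_smul b b' l := by ext <;> simp [add_smul, add_mul]
  zero_smul l := by ext <;> simp

instance [Module.Projective B M] : Module.Projective B (Row M B) :=
  Module.Projective.of_split (M := M × B)
    { toFun := fun l => (l.m, l.b), map_add' := fun _ _ => rfl, map_smul' := fun _ _ => rfl }
    { toFun := fun l => ⟨l.1, l.2⟩, map_add' := fun _ _ => rfl, map_smul' := fun _ _ => rfl }
    rfl

instance : SMul (Op A N M B) (Row M B) :=
  ⟨fun x l => ⟨MulOpposite.op x.unop.a • l.m + l.b • x.unop.m, l.b * x.unop.b⟩⟩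

@[simp] theorem op_smul_m (x : Op A N M B) (l : Row M B) :
    (x • l).m = MulOpposite.op x.unop.a • l.m + l.b • x.unop.m := rfl
@[simp] theorem op_smul_b (x : Op A N M B) (l : Row M B) : (x • l).b = l.b * x.unop.b := rfl

instance : Module (Op A N M B) (Row M B) where
  one_smul l := by ext <;> simp
  mul_smul x y l := by
    ext
    · simp [mul_smul, add_assoc, smul_comm]
    · simp [mul_assoc]
  smul_zero x := by ext <;> simp
  smul_add x l l' := by
    ext
    · simp [add_smul]; abel
    · simp [add_mul]
  add_smul x y l := by
    ext
    · simp [add_smul]; abel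
    · simp [mul_add]
  zero_smul l := by ext <;> simp

instance : SMulCommClass B (Op A N M B) (Row M B) where
  smul_comm b x l := by
    ext
    · simp [mul_smul, smul_comm]
    · simp [mul_assoc]

variable (A N) in
/-- The row `(M, B)` as a right ideal of the Morita context ring. -/
def toMorita (l : Row M B) : MoritaRing A N M B := ⟨0, 0, l.m, l.b⟩

@[simp] theorem toMorita_a (l : Row M B) : (toMorita A N l).a = 0 := rfl
@[simp] theorem toMorita_n (l : Row M B) : (toMorita A N l).n = 0 := rfl
@[simp] theorem toMorita_m (l : Row M B) : (toMorita A N l).m = l.m := rfl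
@[simp] theorem toMorita_b (l : Row M B) : (toMorita A N l).b = l.b := rfl

theorem toMorita_add (l l' : Row M B) :
    toMorita A N (l + l') = toMorita A N l + toMorita A N l' := by
  ext <;> simp

theorem toMorita_smul (b : B) (l : Row M B) :
    toMorita A N (b • l) = ofB A N M b * toMorita A N l := by
  ext <;> simp

theorem toMorita_op_smul (x : Op A N M B) (l : Row M B) :
    toMorita A N (x • l) = toMorita A N l * x.unop := by
  ext <;> simp

/-- The row `(M, B)` is a retract of the regular right module. -/
theorem exists_retract : ∃ (i : Row M B →ₗ[Op A N M B] Op A N M B)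
    (p : Op A N M B →ₗ[Op A N M B] Row M B), p ∘ₗ i = LinearMap.id := by
  refine ⟨{ toFun := fun l => MulOpposite.op (toMorita A N l), map_add' := ?_, map_smul' := ?_ },
    { toFun := fun x => ⟨x.unop.m, x.unop.b⟩, map_add' := ?_, map_smul' := ?_ }, ?_⟩
  · exact fun l l' => congrArg MulOpposite.op (toMorita_add l l')
  · exact fun x l => congrArg MulOpposite.op (toMorita_op_smul x l)
  · exact fun x y => rfl
  · exact fun x y => rfl
  · exact LinearMap.ext fun l => rfl

instance : Module.Projective (Op A N M B) (Row M B) := by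
  obtain ⟨i, p, h⟩ := exists_retract (A := A) (N := N) (M := M) (B := B)
  exact Module.Projective.of_split i p h

instance : Module.Finite (Op A N M B) (Row M B) := by
  obtain ⟨i, p, h⟩ := exists_retract (A := A) (N := N) (M := M) (B := B)
  exact Module.Finite.of_surjective p fun l => ⟨i l, LinearMap.congr_fun h l⟩

end Row

/-! #### The corner functor -/

section Corner

variable (A N M B) in
/-- The second component `Z e₂` of a right module `Z` over the Morita context ring. -/
def Corner (Z : Type u) [AddCommGroup Z] [Module (Op A N M B) Z] : Type u :=
  (LinearMap.ker (((DistribSMul.toAddMonoidHom Z (MulOpposite.op (ofB A N M (1 : B)))) -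
    AddMonoidHom.id Z).toIntLinearMap))

variable {Z Z' Z'' : Type u} [AddCommGroup Z] [Module (Op A N M B) Z] [AddCommGroup Z']
  [Module (Op A N M B) Z'] [AddCommGroup Z''] [Module (Op A N M B) Z'']

namespace Corner

instance : AddCommGroup (Corner A N M B Z) := by unfold Corner; infer_instance

/-- The inclusion of `Z e₂` in `Z`. -/
def val : Corner A N M B Z →+ Z := AddSubgroupClass.subtype (LinearMap.ker
  (((DistribSMul.toAddMonoidHom Z (MulOpposite.op (ofB A N M (1 : B)))) -
    AddMonoidHom.id Z).toIntLinearMap))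

theorem val_injective : Function.Injective (val : Corner A N M B Z →+ Z) :=
  Subtype.val_injective

@[ext] theorem ext {y y' : Corner A N M B Z} (h : val y = val y') : y = y' := val_injective h

theorem smul_val (y : Corner A N M B Z) :
    MulOpposite.op (ofB A N M (1 : B)) • val y = val y := by
  obtain ⟨z, hz⟩ := y
  exact sub_eq_zero.1 hz

/-- An element of `Z` fixed by `e₂`, as an element of `Z e₂`. -/
def mk (z : Z) (hz : MulOpposite.op (ofB A N M (1 : B)) • z = z) : Corner A N M B Z :=
  ⟨z, sub_eq_zero.2 hz⟩

@[simp] theorem val_mk (z : Z) (hz : MulOpposite.op (ofB A N M (1 : B)) • z = z) :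
    val (mk z hz) = z := rfl

theorem smul_ofB_smul (b : B) (z : Z) : MulOpposite.op (ofB A N M (1 : B)) •
    MulOpposite.op (ofB A N M b) • z = MulOpposite.op (ofB A N M b) • z := by
  rw [← mul_smul, ← MulOpposite.op_mul, ← ofB_mul, mul_one]

instance : SMul Bᵐᵒᵖ (Corner A N M B Z) :=
  ⟨fun b y => mk (MulOpposite.op (ofB A N M b.unop) • val y) (smul_ofB_smul _ _)⟩

@[simp] theorem val_smul (b : Bᵐᵒᵖ) (y : Corner A N M B Z) :
    val (b • y) = MulOpposite.op (ofB A N M b.unop) • val y := rfl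

instance : Module Bᵐᵒᵖ (Corner A N M B Z) where
  one_smul y := by ext; simp [smul_val]
  mul_smul b b' y := by ext; simp [ofB_mul, mul_smul]
  smul_zero b := by ext; simp
  smul_add b y y' := by ext; simp
  add_smul b b' y := by ext; simp [ofB_add, add_smul]
  zero_smul y := by ext; simp [ofB_zero]

/-- The projection `Z → Z e₂`. -/
def cut : Z →+ Corner A N M B Z :=
  AddMonoidHom.mk' (fun z => mk (MulOpposite.op (ofB A N M (1 : B)) • z) (smul_ofB_smul _ _))
    fun z z' => by ext; simp

@[simp] theorem val_cut (z : Z) :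
    val (cut z : Corner A N M B Z) = MulOpposite.op (ofB A N M (1 : B)) • z := rfl

theorem cut_val (y : Corner A N M B Z) : cut (val y) = y := by ext; simp [smul_val]

/-- The corner functor on linear maps. -/
def map (f : Z →ₗ[Op A N M B] Z') : Corner A N M B Z →ₗ[Bᵐᵒᵖ] Corner A N M B Z' where
  toFun y := mk (f (val y)) (by rw [← map_smul, smul_val])
  map_add' y y' := by ext; simp
  map_smul' b y := by ext; simp

@[simp] theorem val_map (f : Z →ₗ[Op A N M B] Z') (y : Corner A N M B Z) :
    val (map f y) = f (val y) := rfl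

theorem map_cut (f : Z →ₗ[Op A N M B] Z') (z : Z) : map f (cut z) = cut (f z) := by
  ext; simp

theorem map_injective {f : Z →ₗ[Op A N M B] Z'} (hf : Function.Injective f) :
    Function.Injective (map f) := fun _ _ h => ext (hf (congrArg val h))

theorem map_surjective {f : Z →ₗ[Op A N M B] Z'} (hf : Function.Surjective f) :
    Function.Surjective (map f) := fun y => by
  obtain ⟨z, hz⟩ := hf (val y)
  exact ⟨cut z, by rw [map_cut, hz, cut_val]⟩

theorem map_exact {f : Z →ₗ[Op A N M B] Z'} {g : Z' →ₗ[Op A N M B] Z''}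
    (h : Function.Exact f g) : Function.Exact (map f) (map g) := fun y => by
  constructor
  · intro hy
    obtain ⟨z, hz⟩ := (h (val y)).1 (congrArg val hy)
    exact ⟨cut z, by rw [map_cut, hz, cut_val]⟩
  · rintro ⟨z, rfl⟩
    ext
    exact h.apply_apply_eq_zero _

theorem map_SES (h : SES (Op A N M B) Z Z' Z'') :
    SES Bᵐᵒᵖ (Corner A N M B Z) (Corner A N M B Z') (Corner A N M B Z'') := by
  obtain ⟨i, p, hi, hip, hp⟩ := h
  exact ⟨map i, map p, map_injective hi, map_exact hip, map_surjective hp⟩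

/-- The corner functor on linear equivalences. -/
noncomputable def congr (e : Z ≃ₗ[Op A N M B] Z') : Corner A N M B Z ≃ₗ[Bᵐᵒᵖ] Corner A N M B Z' :=
  LinearEquiv.ofBijective (map e.toLinearMap)
    ⟨map_injective e.injective, map_surjective e.surjective⟩

instance [Subsingleton Z] : Subsingleton (Corner A N M B Z) := val_injective.subsingleton

/-- The map `W ↦ WΛ` from submodules of `Z e₂` to submodules of `Z` reflects the order, because
`(WΛ)e₂ = W`. Hence the ascending chain condition passes from `Z` to `Z e₂`. -/
theorem finite [IsNoetherianRing (Op A N M B)] [Module.Finite (Op A N M B) Z] :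
    Module.Finite Bᵐᵒᵖ (Corner A N M B Z) := by
  let F : Submodule Bᵐᵒᵖ (Corner A N M B Z) → Submodule (Op A N M B) Z :=
    fun W => Submodule.span _ (val '' (W : Set (Corner A N M B Z)))
  have hcut : ∀ W, ∀ z ∈ F W, ∀ x : MoritaRing A N M B, cut (MulOpposite.op x • z) ∈ W := by
    intro W z hz
    induction hz using Submodule.span_induction with
    | mem z hz =>
      obtain ⟨y, hy, rfl⟩ := hz
      intro x
      -- This is `e₂ x e₂ = x.b`: the corner ring `e₂Λe₂` is `B`.
      have h : cut (MulOpposite.op x • val y) = MulOpposite.op x.b • y := by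
        ext
        rw [val_cut, val_smul, ← smul_val y, ← mul_smul, ← mul_smul, ← mul_smul,
          ← MulOpposite.op_mul, ← MulOpposite.op_mul, ← MulOpposite.op_mul]
        congr 2
        ext <;> simp
      rw [h]
      exact W.smul_mem _ hy
    | zero => intro x; simp
    | add z z' _ _ h h' => intro x; rw [smul_add, map_add]; exact W.add_mem (h x) (h' x)
    | smul c z _ h =>
      intro x
      rw [← mul_smul]
      exact h (c.unop * x)
  have hF : ∀ W W', F W ≤ F W' → W ≤ W' := fun W W' h y hy => by
    have h1 := hcut W' (val y) (h (Submodule.subset_span ⟨y, hy, rfl⟩)) 1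
    rwa [MulOpposite.op_one, one_smul, cut_val] at h1
  have hmono : Monotone F := fun W W' h => Submodule.span_mono (Set.image_mono h)
  have hs : StrictMono F := fun W W' h => lt_of_le_not_ge (hmono h.le)
    fun h' => h.not_ge (hF _ _ h')
  have hN : IsNoetherian (Op A N M B) Z := inferInstance
  have hwf : WellFoundedGT (Submodule (Op A N M B) Z) := isNoetherian_iff'.1 hN
  have : IsNoetherian Bᵐᵒᵖ (Corner A N M B Z) := isNoetherian_iff'.2 hs.wellFoundedGT
  infer_instance

/-- As a right `B`-module `Λe₂` is `N × B`, which is projective; a retract of `Λ^n` yields a retract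
of `(N × B)^n`. -/
theorem isFGProjective [IsNoetherianRing (Op A N M B)] [Module.Projective Bᵐᵒᵖ N]
    {P : ModuleCat.{u} (Op A N M B)} (hP : IsFGProjective (Op A N M B) P) :
    IsFGProjective Bᵐᵒᵖ (ModuleCat.of Bᵐᵒᵖ (Corner A N M B P)) := by
  have hP1 := hP.1
  refine ⟨finite, ?_⟩
  obtain ⟨n, g, f, hfg⟩ := IsInAdd.of_isFGProjective hP
  change P →ₗ[Op A N M B] (Fin n → Op A N M B) at g
  change (Fin n → Op A N M B) →ₗ[Op A N M B] P at f
  have hfix : ∀ c : N × Bᵐᵒᵖ, (⟨0, c.1, 0, c.2.unop⟩ : MoritaRing A N M B) * ofB A N M 1 =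
      ⟨0, c.1, 0, c.2.unop⟩ := fun c => by ext <;> simp
  let α : Corner A N M B P →ₗ[Bᵐᵒᵖ] (Fin n → N × Bᵐᵒᵖ) :=
    { toFun := fun y j => ((g (val y) j).unop.n, MulOpposite.op (g (val y) j).unop.b)
      map_add' := fun y y' => by ext <;> simp
      map_smul' := fun b y => by ext <;> simp }
  let β : (Fin n → N × Bᵐᵒᵖ) →ₗ[Bᵐᵒᵖ] Corner A N M B P :=
    { toFun := fun c => mk (f fun j => MulOpposite.op ⟨0, (c j).1, 0, (c j).2.unop⟩) (by
        rw [← map_smul]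
        congr 1
        ext1 j
        exact congrArg MulOpposite.op (hfix (c j)))
      map_add' := fun c c' => by
        ext
        rw [map_add, val_mk, val_mk, val_mk, ← map_add]
        congr 1
        ext1 j
        apply MulOpposite.unop_injective
        ext <;> simp
      map_smul' := fun b c => by
        ext
        rw [RingHom.id_apply, val_smul, val_mk, val_mk, ← map_smul]
        congr 1
        ext1 j
        apply MulOpposite.unop_injective
        ext <;> simp }
  refine Module.Projective.of_split α β (LinearMap.ext fun y => ext ?_)
  have h1 : f (g (val y)) = val y := LinearMap.congr_fun hfg _
  refine Eq.trans ?_ h1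
  change f _ = f _
  congr 1
  ext1 j
  have h2 : g (val y) j = MulOpposite.op (ofB A N M (1 : B)) • g (val y) j := by
    conv_lhs => rw [← smul_val y, map_smul]
    rfl
  rw [h2]
  apply MulOpposite.unop_injective
  ext <;> simp [α]

end Corner

end Corner

end MoritaRing

namespace MoritaRing

variable {A N M B : Type u} [Ring A] [Ring B] [AddCommGroup N] [AddCommGroup M]
  [Module A N] [Module Bᵐᵒᵖ N] [Module B M] [Module Aᵐᵒᵖ M] [SMulCommClass A Bᵐᵒᵖ N]
  [SMulCommClass B Aᵐᵒᵖ M]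

/-! #### The induction functor -/

section Induced

open BTensor

variable {Y : Type u} [AddCommGroup Y] [Module Bᵐᵒᵖ Y]

namespace Induced

/-- Since `B ⊗_B e₂Λ = e₂Λ`, induction turns a retract of `B^n` into a retract of `(e₂Λ)^n`. -/
theorem exists_retract {n : ℕ} (g : Y →ₗ[Bᵐᵒᵖ] (Fin n → Bᵐᵒᵖ)) (f : (Fin n → Bᵐᵒᵖ) →ₗ[Bᵐᵒᵖ] Y)
    (hfg : ∀ y, f (g y) = y) :
    ∃ (α : BTensor B Y (Row M B) →ₗ[Op A N M B] (Fin n → Row M B))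
      (β : (Fin n → Row M B) →ₗ[Op A N M B] BTensor B Y (Row M B)),
      β ∘ₗ α = LinearMap.id := by
  let α₀ : BTensor B Y (Row M B) →+ (Fin n → Row M B) :=
    lift (AddMonoidHom.mk' (fun y => AddMonoidHom.mk' (fun l j => (g y j).unop • l)
        fun l l' => by ext1 j; simp)
      fun y y' => by ext1 l; ext1 j; simp [add_smul]) fun y b l => by
        ext1 j
        simp [mul_smul]
  let α : BTensor B Y (Row M B) →ₗ[Op A N M B] (Fin n → Row M B) :=
    { toFun := α₀
      map_add' := map_add α₀
      map_smul' := fun x z => by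
        induction z using induction_on with
        | tmul y l => ext1 j; exact smul_comm (g y j).unop x l
        | add z z' h h' => rw [smul_add, _root_.map_add, h, h', _root_.map_add]; simp }
  let β : (Fin n → Row M B) →ₗ[Op A N M B] BTensor B Y (Row M B) :=
    { toFun := fun c => ∑ j, tmul B (f (Pi.single j 1)) (c j)
      map_add' := fun c c' => by simp [tmul_add, Finset.sum_add_distrib]
      map_smul' := fun x c => by simp [Finset.smul_sum] }
  refine ⟨α, β, linearMap_ext fun y l => ?_⟩
  change ∑ j, tmul B (f (Pi.single j 1)) ((g y j).unop • l) = tmul B y l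
  simp_rw [← smul_tmul, ← sum_tmul, MulOpposite.op_unop, ← map_smul, ← map_sum]
  congr 1
  refine Eq.trans ?_ (hfg y)
  congr 1
  ext1 j
  simp [Finset.sum_apply, Pi.single_apply]

theorem finite [Module.Finite Bᵐᵒᵖ Y] :
    Module.Finite (Op A N M B) (BTensor B Y (Row M B)) := by
  obtain ⟨n, f, hf⟩ := Module.Finite.exists_fin' Bᵐᵒᵖ Y
  obtain ⟨α, β, h⟩ := exists_retract (A := A) (N := N) (M := M)
    (LinearMap.id : (Fin n → Bᵐᵒᵖ) →ₗ[Bᵐᵒᵖ] _) LinearMap.id fun _ => rfl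
  have h1 : Module.Finite (Op A N M B) (BTensor B (Fin n → Bᵐᵒᵖ) (Row M B)) :=
    Module.Finite.of_surjective β fun z => ⟨α z, LinearMap.congr_fun h z⟩
  exact Module.Finite.of_surjective _ (BTensor.map_surjective (T := Op A N M B) (L := Row M B) hf)

theorem isFGProjective {P : ModuleCat.{u} Bᵐᵒᵖ} (hP : IsFGProjective Bᵐᵒᵖ P) :
    IsFGProjective (Op A N M B) (ModuleCat.of (Op A N M B) (BTensor B P (Row M B))) := by
  have := hP.1
  refine ⟨finite, ?_⟩
  obtain ⟨n, g, f, hfg⟩ := IsInAdd.of_isFGProjective hP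
  obtain ⟨α, β, h⟩ := exists_retract (A := A) (N := N) (M := M) g f (LinearMap.congr_fun hfg)
  exact Module.Projective.of_split α β h

/-- The induced module restricts to the original one. -/
theorem exists_corner_equiv :
    Nonempty (Corner A N M B (BTensor B Y (Row M B)) ≃ₗ[Bᵐᵒᵖ] Y) := by
  -- The map `σ` sends `y ⊗ (m, b)` to `y b`. Multiplication by `e₂` kills the `M`-part of the row,
  -- so `z e₂ = σ(z) ⊗ e₂`, and `σ` inverts `y ↦ y ⊗ e₂` on the corner.
  let σ : BTensor B Y (Row M B) →+ Y :=
    lift (AddMonoidHom.mk' (fun y => AddMonoidHom.mk' (fun l => MulOpposite.op l.b • y)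
        fun l l' => by simp [add_smul])
      fun y y' => by ext l; simp) fun y b l => by simp [mul_smul]
  have hσ : ∀ z, MulOpposite.op (ofB A N M (1 : B)) • z = tmul B (σ z) (⟨0, 1⟩ : Row M B) := by
    intro z
    induction z using induction_on with
    | tmul y l =>
      change _ = tmul B (MulOpposite.op l.b • y) _
      rw [smul_tmul, smul_tmul_right]
      congr 1
      ext <;> simp
    | add z z' h h' => rw [smul_add, h, h', _root_.map_add, add_tmul]
  let η : Y →ₗ[Bᵐᵒᵖ] Corner A N M B (BTensor B Y (Row M B)) :=
    { toFun := fun y => Corner.mk (tmul B y (⟨0, 1⟩ : Row M B)) (by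
        rw [smul_tmul_right]
        congr 1
        ext <;> simp)
      map_add' := fun y y' => Corner.ext (add_tmul y y' _)
      map_smul' := fun b y => Corner.ext (by
        change tmul B (b • y) _ = _
        rw [← MulOpposite.op_unop b, smul_tmul]
        refine congrArg (tmul B y) ?_
        ext <;> simp) }
  have hση : ∀ y, σ (Corner.val (η y)) = y := fun y => one_smul Bᵐᵒᵖ y
  refine ⟨(LinearEquiv.ofBijective η ⟨Function.LeftInverse.injective
    (g := fun z : Corner A N M B _ => σ (Corner.val z)) hση,
    fun z => ⟨σ (Corner.val z), Corner.ext ?_⟩⟩).symm⟩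
  exact (hσ _).symm.trans (Corner.smul_val z)

end Induced

end Induced

/-! #### The counit and its cokernel -/

section Coker

open BTensor

variable {Z Z' Z'' : Type u} [AddCommGroup Z] [Module (Op A N M B) Z] [AddCommGroup Z']
  [Module (Op A N M B) Z'] [AddCommGroup Z''] [Module (Op A N M B) Z'']

variable (A N M B) in
/-- The multiplication map `Z e₂ ⊗_B e₂ Λ → Z`. -/
def counit (Z : Type u) [AddCommGroup Z] [Module (Op A N M B) Z] :
    BTensor B (Corner A N M B Z) (Row M B) →ₗ[Op A N M B] Z :=
  let ε : BTensor B (Corner A N M B Z) (Row M B) →+ Z :=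
    lift (AddMonoidHom.mk' (fun y => AddMonoidHom.mk'
        (fun l => MulOpposite.op (Row.toMorita A N l) • Corner.val y)
        fun l l' => by rw [Row.toMorita_add, MulOpposite.op_add, add_smul])
      fun y y' => by ext l; simp) fun y b l => by
        simp [Row.toMorita_smul, mul_smul]
  { toFun := ε
    map_add' := _root_.map_add ε
    map_smul' := fun x z => by
      induction z using induction_on with
      | tmul y l =>
        change MulOpposite.op (Row.toMorita A N (x • l)) • Corner.val y =
          x • MulOpposite.op (Row.toMorita A N l) • Corner.val y
        rw [Row.toMorita_op_smul, MulOpposite.op_mul, mul_smul, MulOpposite.op_unop]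
      | add z z' h h' => rw [smul_add, _root_.map_add, h, h', _root_.map_add, smul_add] }

@[simp] theorem counit_tmul (y : Corner A N M B Z) (l : Row M B) :
    counit A N M B Z (tmul B y l) = MulOpposite.op (Row.toMorita A N l) • Corner.val y := rfl

/-- The functor `Z ↦ Z e₂ ⊗_B e₂ Λ` on linear maps. -/
def inducedCornerMap (f : Z →ₗ[Op A N M B] Z') :
    BTensor B (Corner A N M B Z) (Row M B) →ₗ[Op A N M B]
      BTensor B (Corner A N M B Z') (Row M B) :=
  BTensor.map (Op A N M B) (Row M B) (Corner.map f)

theorem counit_naturality (f : Z →ₗ[Op A N M B] Z')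
    (w : BTensor B (Corner A N M B Z) (Row M B)) :
    counit A N M B Z' (inducedCornerMap f w) = f (counit A N M B Z w) := by
  induction w using induction_on with
  | tmul y l => exact (map_smul f _ _).symm
  | add z z' h h' => simp only [_root_.map_add, h, h']

/-- Naturality of the counit, together with flatness of `e₂Λ` over `B`, passes injectivity to
submodules. -/
theorem counit_injective_of_injective [Module.Projective B M] {f : Z →ₗ[Op A N M B] Z'}
    (hf : Function.Injective f) (h : Function.Injective (counit A N M B Z')) :
    Function.Injective (counit A N M B Z) := by
  have h1 : Function.Injective (inducedCornerMap f) :=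
    BTensor.map_injective (Corner.map_injective hf)
  refine Function.Injective.of_comp (f := f) fun w w' hw => h1 (h ?_)
  rw [counit_naturality, counit_naturality]
  exact hw

/-- Splitting `Λe₂ = N ⊕ B` and `e₂Λ = M ⊕ B` expands the tensor product into four summands. The
summand `N ⊗_B M` vanishes and the others are the entries `n`, `m`, `b` of a matrix; `ν` rebuilds
the tensor from these entries. -/
theorem counit_injective_self (h : Subsingleton (BTensor B N M)) :
    Function.Injective (counit A N M B (Op A N M B)) := by
  let ofN : N →ₗ[Bᵐᵒᵖ] Corner A N M B (Op A N M B) :=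
    { toFun := fun n => Corner.mk (MulOpposite.op ⟨0, n, 0, 0⟩) (by
        apply MulOpposite.unop_injective
        ext <;> simp)
      map_add' := fun n n' => by
        ext
        apply MulOpposite.unop_injective
        ext <;> simp
      map_smul' := fun b n => by
        ext
        apply MulOpposite.unop_injective
        ext <;> simp }
  let e : Corner A N M B (Op A N M B) := Corner.mk (MulOpposite.op (ofB A N M 1)) (by
    apply MulOpposite.unop_injective
    ext <;> simp)
  let ofM : M →ₗ[B] Row M B :=
    { toFun := fun m => ⟨m, 0⟩
      map_add' := fun m m' => by ext <;> simp
      map_smul' := fun b m => by ext <;> simp }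
  have hNM : ∀ n m, tmul B (ofN n) (ofM m) = 0 := fun n m => by
    have h1 : tmul B n m = 0 := Subsingleton.elim _ _
    rw [← mapHom_tmul, h1, _root_.map_zero]
  have hC : ∀ y : Corner A N M B (Op A N M B),
      y = ofN (Corner.val y).unop.n + MulOpposite.op (Corner.val y).unop.b • e := by
    intro y
    ext
    conv_lhs => rw [← Corner.smul_val y]
    apply MulOpposite.unop_injective
    ext <;> simp [ofN, e]
  have hR : ∀ l : Row M B, l = ofM l.m + l.b • (⟨0, 1⟩ : Row M B) := by
    intro l
    ext <;> simp [ofM]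
  let ν : MoritaRing A N M B →+ BTensor B (Corner A N M B (Op A N M B)) (Row M B) :=
    AddMonoidHom.mk' (fun x => tmul B (ofN x.n) (⟨0, 1⟩ : Row M B) +
      tmul B e (⟨x.m, x.b⟩ : Row M B)) fun x x' => by
        have h1 : (⟨(x + x').m, (x + x').b⟩ : Row M B) = ⟨x.m, x.b⟩ + ⟨x'.m, x'.b⟩ := rfl
        rw [add_n, _root_.map_add, add_tmul, h1, tmul_add]
        abel
  have hν : ∀ w, ν (counit A N M B (Op A N M B) w).unop = w := by
    intro w
    induction w using induction_on with
    | tmul y l =>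
      have h1 : ν (counit A N M B (Op A N M B) (tmul B y l)).unop =
          tmul B (MulOpposite.op l.b • ofN (Corner.val y).unop.n) (⟨0, 1⟩ : Row M B) +
            tmul B e ((Corner.val y).unop.b • l) := by
        rw [← map_smul]
        change tmul B (ofN _) _ + tmul B e _ = _
        congr 2
        · simp
        · ext <;> simp
      rw [h1]
      conv_rhs => rw [hC y, add_tmul, smul_tmul]
      rw [smul_tmul]
      congr 1
      conv_rhs => rw [hR l, tmul_add, hNM, zero_add]
    | add z z' h h' => rw [_root_.map_add, MulOpposite.unop_add, _root_.map_add, h, h']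
  exact fun w w' hw => by rw [← hν w, ← hν w', hw]

theorem counit_injective_of_isFGProjective (h : Subsingleton (BTensor B N M))
    {P : ModuleCat.{u} (Op A N M B)} (hP : IsFGProjective (Op A N M B) P) :
    Function.Injective (counit A N M B P) := by
  obtain ⟨n, i, p, hip⟩ := isInAdd_iff.1 (IsInAdd.of_isFGProjective hP)
  refine (injective_iff_map_eq_zero _).2 fun w hw => ?_
  -- The functor is additive, so `∑ p_j i_j = 1` persists and reduces the claim to the regular
  -- module.
  have h1 : ∀ w, ∑ j, inducedCornerMap (p j) (inducedCornerMap (i j) w) = w := fun w => by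
    induction w using induction_on with
    | tmul y l =>
      change ∑ j, tmul B (Corner.map (p j) (Corner.map (i j) y)) l = _
      rw [← sum_tmul]
      congr 1
      ext
      rw [map_sum]
      exact hip _
    | add z z' h h' => simp only [_root_.map_add, Finset.sum_add_distrib, h, h']
  rw [← h1 w]
  refine Finset.sum_eq_zero fun j _ => ?_
  have h2 : inducedCornerMap (i j) w = 0 := counit_injective_self h (by
    rw [counit_naturality, hw, _root_.map_zero, _root_.map_zero])
  rw [h2, _root_.map_zero]

variable (A N M B) in
/-- The largest quotient `Z / Z e₂ Λ` of `Z` that is an `A`-module. -/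
def Coker (Z : Type u) [AddCommGroup Z] [Module (Op A N M B) Z] : Type u :=
  Z ⧸ LinearMap.range (counit A N M B Z)

/-- A matrix with zero `A`-entry lies in `Λe₂Λ`: its second row equals `e₂` times itself, and its
`n`-entry equals itself times `e₂`. Hence `Λ` acts on the cokernel through `A`. -/
theorem smul_mem_range_counit (x : MoritaRing A N M B) (hx : x.a = 0) (z : Z) :
    MulOpposite.op x • z ∈ LinearMap.range (counit A N M B Z) := by
  refine ⟨tmul B (Corner.cut z) (⟨x.m, x.b⟩ : Row M B) +
    tmul B (Corner.cut (MulOpposite.op (⟨0, x.n, 0, 0⟩ : MoritaRing A N M B) • z))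
      (⟨0, 1⟩ : Row M B), ?_⟩
  rw [_root_.map_add, counit_tmul, counit_tmul, Corner.val_cut, Corner.val_cut, ← mul_smul,
    ← mul_smul, ← mul_smul, ← add_smul]
  congr 1
  apply MulOpposite.unop_injective
  ext <;> simp [hx]

namespace Coker

instance : AddCommGroup (Coker A N M B Z) :=
  inferInstanceAs (AddCommGroup (Z ⧸ LinearMap.range (counit A N M B Z)))

instance : Module (Op A N M B) (Coker A N M B Z) :=
  inferInstanceAs (Module (Op A N M B) (Z ⧸ LinearMap.range (counit A N M B Z)))

/-- The projection `Z → Z / Z e₂ Λ`. -/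
def mk : Z →ₗ[Op A N M B] Coker A N M B Z := (LinearMap.range (counit A N M B Z)).mkQ

theorem mk_surjective : Function.Surjective (mk : Z →ₗ[Op A N M B] Coker A N M B Z) :=
  Submodule.mkQ_surjective _

theorem mk_eq_zero {z : Z} :
    (mk z : Coker A N M B Z) = 0 ↔ z ∈ LinearMap.range (counit A N M B Z) :=
  Submodule.Quotient.mk_eq_zero _

theorem op_smul_eq_zero (x : MoritaRing A N M B) (hx : x.a = 0) (q : Coker A N M B Z) :
    MulOpposite.op x • q = 0 := by
  obtain ⟨z, rfl⟩ := mk_surjective q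
  rw [← map_smul, mk_eq_zero]
  exact smul_mem_range_counit x hx z

theorem op_smul (x : Op A N M B) (q : Coker A N M B Z) :
    x • q = MulOpposite.op (ofA N M B x.unop.a) • q := by
  rw [← sub_eq_zero, ← sub_smul]
  exact op_smul_eq_zero (x - MulOpposite.op (ofA N M B x.unop.a)).unop (by simp [sub_eq_add_neg]) q

instance : Module Aᵐᵒᵖ (Coker A N M B Z) where
  smul a q := MulOpposite.op (ofA N M B a.unop) • q
  one_smul q := (op_smul (1 : Op A N M B) q).symm.trans (one_smul _ q)
  mul_smul a a' q := by
    change MulOpposite.op (ofA N M B (a * a').unop) • q = MulOpposite.op (ofA N M B a.unop) •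
      MulOpposite.op (ofA N M B a'.unop) • q
    rw [← mul_smul, ← MulOpposite.op_mul, ← ofA_mul, MulOpposite.unop_mul]
  smul_zero a := smul_zero (MulOpposite.op (ofA N M B a.unop))
  smul_add a := smul_add (MulOpposite.op (ofA N M B a.unop))
  add_smul a a' q := by
    change MulOpposite.op (ofA N M B (a + a').unop) • q = MulOpposite.op (ofA N M B a.unop) • q +
      MulOpposite.op (ofA N M B a'.unop) • q
    rw [← add_smul, ← MulOpposite.op_add, ← ofA_add, MulOpposite.unop_add]
  zero_smul q := zero_smul (Op A N M B) q

theorem smul_def (a : Aᵐᵒᵖ) (q : Coker A N M B Z) :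
    a • q = MulOpposite.op (ofA N M B a.unop) • q := rfl

/-- A linear map of modules over the Morita context ring between cokernels is `A`-linear. -/
def linearMap (f : Coker A N M B Z →ₗ[Op A N M B] Coker A N M B Z') :
    Coker A N M B Z →ₗ[Aᵐᵒᵖ] Coker A N M B Z' where
  toFun := f
  map_add' := _root_.map_add f
  map_smul' _ q := map_smul f _ q

/-- The functor `Z ↦ Z / Z e₂ Λ` on linear maps. -/
def map (f : Z →ₗ[Op A N M B] Z') : Coker A N M B Z →ₗ[Aᵐᵒᵖ] Coker A N M B Z' :=
  linearMap (Submodule.mapQ _ _ f (by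
    rintro _ ⟨w, rfl⟩
    exact ⟨inducedCornerMap f w, counit_naturality f w⟩))

@[simp] theorem map_mk (f : Z →ₗ[Op A N M B] Z') (z : Z) : map f (mk z) = mk (f z) := rfl

theorem map_surjective {f : Z →ₗ[Op A N M B] Z'} (hf : Function.Surjective f) :
    Function.Surjective (map f) := fun q => by
  obtain ⟨z, rfl⟩ := mk_surjective q
  obtain ⟨z, rfl⟩ := hf z
  exact ⟨mk z, rfl⟩

/-- This is the snake lemma for the counits: injectivity on `Z''` removes the only obstruction to
injectivity on the left. -/
theorem map_SES [Module.Projective B M] (h : SES (Op A N M B) Z Z' Z'')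
    (hinj : Function.Injective (counit A N M B Z'')) :
    SES Aᵐᵒᵖ (Coker A N M B Z) (Coker A N M B Z') (Coker A N M B Z'') := by
  obtain ⟨i, p, hi, hip, hp⟩ := h
  have hex : Function.Exact (inducedCornerMap i) (inducedCornerMap p) :=
    BTensor.map_exact (Corner.map_exact hip)
  have hsurj : Function.Surjective (inducedCornerMap p) :=
    BTensor.map_surjective (Corner.map_surjective hp)
  refine ⟨map i, map p, (injective_iff_map_eq_zero _).2 fun q hq => ?_, fun q => ⟨fun hq => ?_, ?_⟩,
    map_surjective hp⟩
  · obtain ⟨z, rfl⟩ := mk_surjective q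
    obtain ⟨w, hw⟩ := mk_eq_zero.1 hq
    obtain ⟨w', rfl⟩ := (hex w).1 (hinj (by
      rw [counit_naturality, hw, hip.apply_apply_eq_zero, _root_.map_zero]))
    rw [counit_naturality] at hw
    exact mk_eq_zero.2 ⟨w', hi hw⟩
  · obtain ⟨z, rfl⟩ := mk_surjective q
    obtain ⟨w, hw⟩ := mk_eq_zero.1 hq
    obtain ⟨w', rfl⟩ := hsurj w
    obtain ⟨x, hx⟩ := (hip (z - counit A N M B Z' w')).1 (by
      rw [map_sub, ← counit_naturality, hw, sub_self])
    refine ⟨mk x, ?_⟩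
    rw [map_mk, hx, map_sub, mk_eq_zero.2 ⟨w', rfl⟩, sub_zero]
  · rintro ⟨q', rfl⟩
    obtain ⟨x, rfl⟩ := mk_surjective q'
    rw [map_mk, map_mk, hip.apply_apply_eq_zero, _root_.map_zero]

theorem exists_congr (e : Z ≃ₗ[Op A N M B] Z') :
    Nonempty (Coker A N M B Z ≃ₗ[Aᵐᵒᵖ] Coker A N M B Z') := by
  refine ⟨LinearEquiv.ofLinearMap (map e.toLinearMap) (map e.symm.toLinearMap) ?_ ?_⟩
  all_goals
    refine LinearMap.ext fun q => ?_
    obtain ⟨z, rfl⟩ := mk_surjective q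
    simp

theorem finite [Module.Finite (Op A N M B) Z] : Module.Finite Aᵐᵒᵖ (Coker A N M B Z) := by
  obtain ⟨s, hs⟩ := (Module.Finite.of_surjective (mk : Z →ₗ[Op A N M B] Coker A N M B Z)
    mk_surjective).fg_top
  refine ⟨s, eq_top_iff.2 fun q _ => ?_⟩
  have hq : q ∈ Submodule.span (Op A N M B) (s : Set (Coker A N M B Z)) := by rw [hs]; trivial
  induction hq using Submodule.span_induction with
  | mem q hq => exact Submodule.subset_span hq
  | zero => exact Submodule.zero_mem _
  | add q q' _ _ h h' => exact Submodule.add_mem _ (h trivial) (h' trivial)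
  | smul x q _ h =>
    rw [op_smul]
    exact Submodule.smul_mem _ (MulOpposite.op x.unop.a) (h trivial)

/-- Because `Λ / Λe₂Λ = A`, a retract of `Λ^n` becomes a retract of `A^n`. The map `α` reads off
`A`-entries, which vanish on the image of the counit. -/
theorem isFGProjective {P : ModuleCat.{u} (Op A N M B)} (hP : IsFGProjective (Op A N M B) P) :
    IsFGProjective Aᵐᵒᵖ (ModuleCat.of Aᵐᵒᵖ (Coker A N M B P)) := by
  have := hP.1
  refine ⟨finite, ?_⟩
  obtain ⟨n, i, p, hip⟩ := isInAdd_iff.1 (IsInAdd.of_isFGProjective hP)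
  change Fin n → (P →ₗ[Op A N M B] Op A N M B) at i
  change Fin n → (Op A N M B →ₗ[Op A N M B] P) at p
  let α₀ : P →+ (Fin n → Aᵐᵒᵖ) :=
    AddMonoidHom.mk' (fun z j => MulOpposite.op (i j z).unop.a) fun z z' => by ext1 j; simp
  have hα₀ : ∀ w, α₀ (counit A N M B P w) = 0 := fun w => by
    induction w using induction_on with
    | tmul y l =>
      ext1 j
      apply MulOpposite.unop_injective
      simp [α₀]
    | add z z' h h' => rw [_root_.map_add, _root_.map_add, h, h', add_zero]
  let α₁ : Coker A N M B P →+ (Fin n → Aᵐᵒᵖ) :=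
    QuotientAddGroup.lift (LinearMap.range (counit A N M B P)).toAddSubgroup α₀ (by
      rintro _ ⟨w, rfl⟩
      exact hα₀ w)
  have hα₁ : ∀ z, α₁ (mk z) = α₀ z := fun z => rfl
  let α : Coker A N M B P →ₗ[Aᵐᵒᵖ] (Fin n → Aᵐᵒᵖ) :=
    { toFun := α₁
      map_add' := _root_.map_add α₁
      map_smul' := fun a q => by
        obtain ⟨z, rfl⟩ := mk_surjective q
        rw [smul_def, ← map_smul, hα₁, hα₁]
        ext1 j
        apply MulOpposite.unop_injective
        simp [α₀] }
  let β : (Fin n → Aᵐᵒᵖ) →ₗ[Aᵐᵒᵖ] Coker A N M B P :=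
    ∑ j, (LinearMap.toSpanSingleton Aᵐᵒᵖ _ (mk (p j 1))) ∘ₗ LinearMap.proj j
  refine Module.Projective.of_split α β (LinearMap.ext fun q => ?_)
  obtain ⟨z, rfl⟩ := mk_surjective q
  have h1 : β (α (mk z)) = ∑ j, MulOpposite.op (i j z).unop.a • mk (p j 1) := by
    simp only [β, LinearMap.sum_apply]
    rfl
  have h2 : ∀ j, MulOpposite.op (i j z).unop.a • (mk (p j 1) : Coker A N M B P) =
      mk (p j (i j z)) := fun j => by
    rw [smul_def, MulOpposite.unop_op, ← op_smul, ← map_smul, ← map_smul, smul_eq_mul, mul_one]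
  rw [LinearMap.comp_apply, h1, Finset.sum_congr rfl fun j _ => h2 j, ← map_sum]
  exact congrArg mk (hip z)

end Coker

end Coker

end MoritaRing

namespace MoritaRing

variable {A N M B : Type u} [Ring A] [Ring B] [AddCommGroup N] [AddCommGroup M]
  [Module A N] [Module Bᵐᵒᵖ N] [Module B M] [Module Aᵐᵒᵖ M] [SMulCommClass A Bᵐᵒᵖ N]
  [SMulCommClass B Aᵐᵒᵖ M]

variable (A N M B) in
/-- The projection to `A`, on opposite rings. -/
def toA : Op A N M B →+* Aᵐᵒᵖ where
  toFun x := MulOpposite.op x.unop.a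
  map_one' := rfl
  map_mul' _ _ := rfl
  map_zero' := rfl
  map_add' _ _ := rfl

variable (A N M B) in
/-- The projection to `B`, on opposite rings. -/
def toB : Op A N M B →+* Bᵐᵒᵖ where
  toFun x := MulOpposite.op x.unop.b
  map_one' := rfl
  map_mul' _ _ := rfl
  map_zero' := rfl
  map_add' _ _ := rfl

variable (A N M B) in
theorem isNoetherianRing_left [IsNoetherianRing (Op A N M B)] : IsNoetherianRing Aᵐᵒᵖ :=
  isNoetherianRing_of_surjective _ _ (toA A N M B)
    fun a => ⟨MulOpposite.op (ofA N M B a.unop), rfl⟩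

variable (A N M B) in
theorem isNoetherianRing_right [IsNoetherianRing (Op A N M B)] : IsNoetherianRing Bᵐᵒᵖ :=
  isNoetherianRing_of_surjective _ _ (toB A N M B)
    fun b => ⟨MulOpposite.op (ofB A N M b.unop), rfl⟩

/-! #### Inflation of `A`-modules -/

/-- A right `A`-module, regarded as a right module over the Morita context ring. -/
def Inflate (V : Type u) : Type u := V

namespace Inflate

variable {V V' V'' : Type u} [AddCommGroup V] [Module Aᵐᵒᵖ V] [AddCommGroup V'] [Module Aᵐᵒᵖ V']
  [AddCommGroup V''] [Module Aᵐᵒᵖ V'']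

instance : AddCommGroup (Inflate V) := inferInstanceAs (AddCommGroup V)

instance : Module (Op A N M B) (Inflate V) :=
  Module.compHom V (toA A N M B)

/-- Inflation on linear maps. -/
def map (f : V →ₗ[Aᵐᵒᵖ] V') : Inflate V →ₗ[Op A N M B] Inflate V' where
  toFun := f
  map_add' := map_add f
  map_smul' x v := f.map_smul (toA A N M B x) v

theorem map_SES (h : SES Aᵐᵒᵖ V V' V'') :
    SES (Op A N M B) (Inflate V) (Inflate V') (Inflate V'') := by
  obtain ⟨i, p, hi, hip, hp⟩ := h
  exact ⟨map i, map p, hi, hip, hp⟩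

/-- Inflation on linear equivalences. -/
def congr (e : V ≃ₗ[Aᵐᵒᵖ] V') : Inflate V ≃ₗ[Op A N M B] Inflate V' :=
  { map e.toLinearMap with
    invFun := e.symm
    left_inv := e.left_inv
    right_inv := e.right_inv }

theorem finite [h : Module.Finite Aᵐᵒᵖ V] : Module.Finite (Op A N M B) (Inflate V) := by
  obtain ⟨s, hs⟩ := h.fg_top
  let s' : Finset (Inflate V) := s
  refine ⟨s', eq_top_iff.2 fun (q : V) _ => ?_⟩
  have hq : q ∈ Submodule.span Aᵐᵒᵖ (s : Set V) := by rw [hs]; trivial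
  induction hq using Submodule.span_induction with
  | mem q hq => exact Submodule.subset_span hq
  | zero => exact Submodule.zero_mem _
  | add q q' _ _ h h' => exact Submodule.add_mem _ (h trivial) (h' trivial)
  | smul x q _ h =>
    exact Submodule.smul_mem _ (MulOpposite.op (ofA N M B x.unop)) (h trivial)

/-- The inflation of `Z / Z e₂ Λ`. -/
def cokerEquiv (Z : Type u) [AddCommGroup Z] [Module (Op A N M B) Z] :
    Inflate (Coker A N M B Z) ≃ₗ[Op A N M B] Coker A N M B Z where
  toFun := id
  map_add' _ _ := rfl
  map_smul' x q := (Coker.op_smul x q).symm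
  invFun := id
  left_inv _ := rfl
  right_inv _ := rfl

end Inflate

/-! #### Transport of resolutions and syzygies -/

theorem AddResolution.induced [Module.Projective B M] {V X : ModuleCat.{u} Bᵐᵒᵖ} {n : ℕ}
    (h : AddResolution V n X) :
    AddResolution (ModuleCat.of (Op A N M B) (BTensor B V (Row M B))) n
      (ModuleCat.of (Op A N M B) (BTensor B X (Row M B))) := by
  have h1 := Chain.map (ℰ := IsInAdd (Op A N M B)
      (ModuleCat.of (Op A N M B) (BTensor B V (Row M B))))
    (fun X => ModuleCat.of (Op A N M B) (BTensor B X (Row M B))) (fun _ => True)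
    (fun X Y e => ⟨BTensor.congr (Op A N M B) (Row M B) e⟩)
    (fun C hC => hC.map (T := fun X => ModuleCat.of (Op A N M B) (BTensor B X (Row M B)))
      (fun _ _ f => BTensor.map (Op A N M B) (Row M B) f) (fun _ => BTensor.map_id)
      (fun _ _ _ g f => BTensor.map_comp g f) fun _ _ f g => BTensor.map_add f g)
    (fun _ _ _ _ _ hs => ⟨trivial, BTensor.map_SES hs⟩) h trivial
  -- The transported chain ends in the image of the zero module, which is zero but not literally
  -- `PUnit`.
  obtain ⟨e⟩ : AddResolution (ModuleCat.of (Op A N M B) PUnit.{u + 1}) 0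
    (ModuleCat.of (Op A N M B) (BTensor B PUnit.{u + 1} (Row M B))) :=
      have : Subsingleton (BTensor B PUnit.{u + 1} (Row M B)) :=
        subsingleton_of_forall_eq 0 fun z => by
        induction z using BTensor.induction_on with
        | tmul y l => exact BTensor.zero_tmul l
        | add z z' h h' => rw [h, h', add_zero]
      AddResolution.of_subsingleton _
  exact h1.congr_left e

theorem AddResolution.corner {V X : ModuleCat.{u} (Op A N M B)} {n : ℕ}
    (h : AddResolution V n X) :
    AddResolution (ModuleCat.of Bᵐᵒᵖ (Corner A N M B V)) n
      (ModuleCat.of Bᵐᵒᵖ (Corner A N M B X)) := by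
  have h1 := Chain.map (ℰ := IsInAdd Bᵐᵒᵖ (ModuleCat.of Bᵐᵒᵖ (Corner A N M B V)))
    (fun X => ModuleCat.of Bᵐᵒᵖ (Corner A N M B X)) (fun _ => True)
    (fun X Y e => ⟨Corner.congr e⟩)
    (fun C hC => hC.map (T := fun X => ModuleCat.of Bᵐᵒᵖ (Corner A N M B X))
      (fun _ _ f => Corner.map f) (fun _ => rfl) (fun _ _ _ g f => rfl) fun _ _ f g => rfl)
    (fun _ _ _ _ _ hs => ⟨trivial, Corner.map_SES hs⟩) h trivial
  obtain ⟨e⟩ : AddResolution (ModuleCat.of Bᵐᵒᵖ PUnit.{u + 1}) 0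
    (ModuleCat.of Bᵐᵒᵖ (Corner A N M B PUnit.{u + 1})) := AddResolution.of_subsingleton _
  exact h1.congr_left e

theorem AddResolution.inflate {V X : ModuleCat.{u} Aᵐᵒᵖ} {n : ℕ} (h : AddResolution V n X) :
    AddResolution (ModuleCat.of (Op A N M B) (Inflate V)) n
      (ModuleCat.of (Op A N M B) (Inflate X)) := by
  have h1 := Chain.map (ℰ := IsInAdd (Op A N M B) (ModuleCat.of (Op A N M B) (Inflate V)))
    (fun X => ModuleCat.of (Op A N M B) (Inflate X)) (fun _ => True)
    (fun X Y e => ⟨Inflate.congr e⟩)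
    (fun C hC => hC.map (T := fun X => ModuleCat.of (Op A N M B) (Inflate X))
      (fun _ _ f => Inflate.map f) (fun _ => rfl) (fun _ _ _ g f => rfl) fun _ _ f g => rfl)
    (fun _ _ _ _ _ hs => ⟨trivial, Inflate.map_SES hs⟩) h trivial
  obtain ⟨e⟩ : AddResolution (ModuleCat.of (Op A N M B) PUnit.{u + 1}) 0
    (ModuleCat.of (Op A N M B) (Inflate PUnit.{u + 1})) :=
      have : Subsingleton (Inflate PUnit.{u + 1}) := inferInstanceAs (Subsingleton PUnit)
      AddResolution.of_subsingleton _
  exact h1.congr_left e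

end MoritaRing

/-! ### Transfer of the Igusa–Todorov property and the bounds on the distance. -/

theorem Chain.exists_syzygy_of_le {S : Type u} [Ring S] [IsNoetherianRing S] {t s : ℕ}
    (hst : s ≤ t) {K X : ModuleCat.{u} S} (h : Chain (IsFGProjective S) t K X)
    (hX : Module.Finite S X) :
    ∃ Y : ModuleCat.{u} S, Module.Finite S Y ∧ IsSyzygy S s K Y := by
  obtain ⟨d, rfl⟩ := Nat.exists_eq_add_of_le hst
  -- Cutting the sequence makes `K` an `s`-th syzygy of the `(t - s)`-th syzygy `Y` of `X`.
  obtain ⟨Y, h1, h2⟩ := h.split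
  exact ⟨Y, h2.finite (fun _ hC => hC.1) hX, HasExactSequence.of_chain h1⟩

namespace MoritaRing

variable {A N M B : Type u} [Ring A] [Ring B] [AddCommGroup N] [AddCommGroup M]
  [Module A N] [Module Bᵐᵒᵖ N] [Module B M] [Module Aᵐᵒᵖ M] [SMulCommClass A Bᵐᵒᵖ N]
  [SMulCommClass B Aᵐᵒᵖ M] [IsNoetherianRing (Op A N M B)] [Module.Projective B M]

theorem isIgusaTodorov [Module.Projective Bᵐᵒᵖ N] (hNM : Subsingleton (BTensor B N M))
    {m r n s : ℕ} (hA : IsIgusaTodorov A m r) (hB : IsIgusaTodorov B n s) :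
    IsIgusaTodorov (MoritaRing A N M B) (2 * m + n + 2) (max r s) := by
  have := isNoetherianRing_left A N M B
  have := isNoetherianRing_right A N M B
  obtain ⟨VA, hVA, hA⟩ := hA
  -- An `(n, s)`-Igusa–Todorov resolution runs over `V_0, …, V_n`, so the left end of the extension
  -- has `n + 1` terms.
  obtain ⟨VB, hVB, hB⟩ := hB
  obtain ⟨U, hU, hext⟩ := AddResolution.exists_extension m (n + 1)
    (V := ModuleCat.of (Op A N M B) (BTensor B VB (Row M B)))
    (W := ModuleCat.of (Op A N M B) (Inflate VA)) Induced.finite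
    (Inflate.finite (V := VA))
  obtain ⟨U', hU', hUU', hSU'⟩ := exists_isInAdd_pair hU
    (W := ModuleCat.of (Op A N M B) (Op A N M B))
    (inferInstanceAs (Module.Finite (Op A N M B) (Op A N M B)))
  refine ⟨U', hU', fun X K hX hK hsyz => HasExactSequence.of_chain ?_⟩
  obtain ⟨L, P, hP, hL⟩ := SES.exists_cover (S := Op A N M B) K
  have hPf := hP.1
  have hLf := hL.finite_left
  have hc : Chain (IsFGProjective (Op A N M B)) (max r s + 1) L X :=
    (HasExactSequence.chain hsyz).snoc hP hL
  have hinj : ∀ {Y C Z : ModuleCat.{u} (Op A N M B)}, IsFGProjective (Op A N M B) C →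
      SES (Op A N M B) Y C Z → Function.Injective (counit A N M B Y) := by
    rintro Y C Z hC ⟨i, -, hi, -, -⟩
    exact counit_injective_of_injective hi (counit_injective_of_isFGProjective hNM hC)
  have hcorner : AddResolution VB (n + 1) (ModuleCat.of Bᵐᵒᵖ (Corner A N M B L)) := by
    have h1 := Chain.map (ℰ := IsFGProjective Bᵐᵒᵖ)
      (fun X => ModuleCat.of Bᵐᵒᵖ (Corner A N M B X)) (fun _ => True)
      (fun X Y e => ⟨Corner.congr e⟩) (fun C hC => Corner.isFGProjective hC)
      (fun _ _ _ _ _ hs => ⟨trivial, Corner.map_SES hs⟩) hc trivial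
    obtain ⟨Y, hY, h2⟩ := h1.exists_syzygy_of_le
      ((le_max_right r s).trans (Nat.le_succ _)) Corner.finite
    exact HasExactSequence.chain (hB Y _ hY Corner.finite h2)
  have hcoker : AddResolution VA (m + 1) (ModuleCat.of Aᵐᵒᵖ (Coker A N M B L)) := by
    -- The counit of `X` itself may fail to be injective. The first step is discarded, and the chain
    -- starts at the syzygy `X' ⊆ Q`, leaving exactly `max r s` steps.
    obtain ⟨Q, X', hQ, hX', hc⟩ := hc
    have hQf := hQ.1
    have hX'f := hX'.finite_left
    have h1 := Chain.map (ℰ := IsFGProjective Aᵐᵒᵖ)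
      (fun X => ModuleCat.of Aᵐᵒᵖ (Coker A N M B X))
      (fun X => Function.Injective (counit A N M B X))
      (fun X Y e => Coker.exists_congr e) (fun C hC => Coker.isFGProjective hC)
      (fun _ _ _ hC hZ hs => ⟨hinj hC hs, Coker.map_SES hs hZ⟩) hc (hinj hQ hX')
    obtain ⟨Y, hY, h2⟩ := h1.exists_syzygy_of_le (le_max_left r s) Coker.finite
    exact HasExactSequence.chain (hA Y _ hY Coker.finite h2)
  have hses : SES (Op A N M B) (BTensor B (Corner A N M B L) (Row M B)) L (Coker A N M B L) :=
    ⟨counit A N M B L, Coker.mk, hinj hP hL,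
      fun z => Coker.mk_eq_zero, Coker.mk_surjective⟩
  have h1 := hext (ModuleCat.of (Op A N M B) (BTensor B (Corner A N M B L) (Row M B))) L
    (ModuleCat.of (Op A N M B) (Coker A N M B L)) hses (AddResolution.induced hcorner)
    ((AddResolution.inflate hcoker).congr_right (Inflate.cokerEquiv L))
  exact ⟨P, L, (IsInAdd.of_isFGProjective hP).trans hSU', hL, AddResolution.mono h1 hUU'⟩

/-- The syzygy is induced up to `Λ`, resolved there, and cut back by `e₂`, which recovers the
original module. The module `V e₂` serves for `B`. -/
theorem isIgusaTodorov_right {m n : ℕ} (h : IsIgusaTodorov (MoritaRing A N M B) m n) :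
    IsIgusaTodorov B m n := by
  obtain ⟨V, hV, h⟩ := h
  refine ⟨ModuleCat.of Bᵐᵒᵖ (Corner A N M B V), Corner.finite, fun X K hX hK hsyz => ?_⟩
  have h1 := Chain.map (ℰ := IsFGProjective (Op A N M B))
    (fun X => ModuleCat.of (Op A N M B) (BTensor B X (Row M B))) (fun _ => True)
    (fun X Y e => ⟨BTensor.congr (Op A N M B) (Row M B) e⟩)
    (fun C hC => Induced.isFGProjective hC)
    (fun _ _ _ _ _ hs => ⟨trivial, BTensor.map_SES hs⟩) (HasExactSequence.chain hsyz) trivial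
  have h2 := AddResolution.corner (HasExactSequence.chain
    (h _ _ Induced.finite Induced.finite (HasExactSequence.of_chain h1)))
  obtain ⟨e⟩ := Induced.exists_corner_equiv (A := A) (N := N) (M := M) (B := B) (Y := K)
  exact HasExactSequence.of_chain (h2.congr_right e)

end MoritaRing

theorem ITDistance_le {R : Type u} [Ring R] {m n : ℕ} (h : IsIgusaTodorov R m n) :
    ITDistance R ≤ m :=
  sInf_le ⟨m, n, rfl, h⟩

/-- A finite distance is attained, because `ℕ∞` is well ordered. -/
theorem exists_isIgusaTodorov {R : Type u} [Ring R] (h : ITDistance R ≠ ⊤) :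
    ∃ m n : ℕ, ITDistance R = m ∧ IsIgusaTodorov R m n := by
  have hne : {d : ℕ∞ | ∃ m n : ℕ, d = m ∧ IsIgusaTodorov R m n}.Nonempty := by
    by_contra hne
    exact h (by rw [ITDistance, Set.not_nonempty_iff_eq_empty.1 hne, sInf_empty])
  exact csInf_mem hne

theorem mainTheorem6
    (A N M B : Type u) [Ring A] [Ring B]
    [AddCommGroup N] [Module A N] [Module Bᵐᵒᵖ N] [SMulCommClass A Bᵐᵒᵖ N]
    [AddCommGroup M] [Module B M] [Module Aᵐᵒᵖ M] [SMulCommClass B Aᵐᵒᵖ M]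
    (k : Type v) [CommRing k] [IsArtinianRing k]
    [Algebra k (MoritaRing A N M B)] [Module.Finite k (MoritaRing A N M B)]
    (hM : Module.Projective B M)
    (hN : Module.Projective Bᵐᵒᵖ N)
    (hNM : Subsingleton (BalancedTensor B N M)) :
    (∀ m r n s : ℕ, IsIgusaTodorov A m r → IsIgusaTodorov B n s →
      IsIgusaTodorov (MoritaRing A N M B) (2 * m + n + 2) (max r s)) ∧
    ITDistance B ≤ ITDistance (MoritaRing A N M B) ∧
    ITDistance (MoritaRing A N M B) ≤ 2 * ITDistance A + ITDistance B + 2 := by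
  have hfin : Module.Finite k (MoritaRing.Op A N M B) :=
    Module.Finite.equiv (MulOpposite.opLinearEquiv k)
  -- The Artin algebra hypothesis enters through this chain condition, which keeps syzygies finitely
  -- generated.
  have hnoeth : IsNoetherianRing (MoritaRing.Op A N M B) :=
    IsNoetherianRing.of_finite k (MoritaRing.Op A N M B)
  refine ⟨fun m r n s hA hB => MoritaRing.isIgusaTodorov hNM hA hB, ?_, ?_⟩
  · refine le_sInf ?_
    rintro _ ⟨m, n, rfl, h⟩
    exact ITDistance_le (MoritaRing.isIgusaTodorov_right h)
  · by_cases hA : ITDistance A = ⊤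
    · simp [hA]
    by_cases hB : ITDistance B = ⊤
    · simp [hB]
    obtain ⟨m, r, hm, hA⟩ := exists_isIgusaTodorov hA
    obtain ⟨n, s, hn, hB⟩ := exists_isIgusaTodorov hB
    rw [hm, hn]
    exact_mod_cast ITDistance_le (MoritaRing.isIgusaTodorov hNM hA hB)
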